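/- Let $n\ge 1$, $T>0$; let $B_R$ be the closed ball of radius $R$ about $0$ in $\mathbb R^n$ and $\mathbb B$ the closed unit ball of $\mathbb R^{n+1}$. For $H:[0,T]\times\mathbb R^n\times\mathbb R^n\to\mathbb R$ let $$L(t,x,v)=\sup_{p\in\mathbb R^n}\{\langle v,p\rangle-H(t,x,p)\}\in\mathbb R\cup\{+\infty\}.$$ Given functions $c:[0,T]\to[0,\infty)$, $k_R:[0,T]\to[0,\infty)$ ($R>0$) and $\lambda:[0,T]\times\mathbb R^n\to\mathbb R$, with $c$ and $k_R$ measurable, we say that $(H,\lambda,k_R,c)$ satisfies the standing hypotheses if, for all $t\in[0,T]$, $x,y,p,q\in\mathbb R^n$, $R>0$: - $H(\cdot,x,p)$ is Lebesgue measurable, $H(t,\cdot,\cdot)$ is continuous, $H(t,x,\cdot)$ is convex; - $|H(t,x,p)-H(t,x,q)|\le c(t)(1+|x|)|p-q|$; - $|H(t,x,p)-H(t,y,p)|\le k_R(t)(1+|p|)|x-y|$ whenever $x,y\in B_R$; - $\lambda(\cdot,x)$ is measurable, $\lambda(t,\cdot)$ is continuous, and $k_R(t)$-Lipschitz on $B_R$,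 and $L(t,x,v)\le\lambda(t,x)$ for every $v$ with $L(t,x,v)$ finite. For such data define $\omega(t,x)=|\lambda(t,x)|+|H(t,x,0)|+c(t)(1+|x|)+1$, $E_L(t,x)=\{(v,\eta)\in\mathbb R^n\times\mathbb R=\mathbb R^{n+1}: L(t,x,v)\le\eta\}$, and, for $a\in\mathbb R^{n+1}$, $$\Phi(t,x,a)=E_L(t,x)\cap\{z\in\mathbb R^{n+1}:|z-\omega(t,x)a|\le 2\,d(\omega(t,x)a,E_L(t,x))\},$$ where $d(y,E)=\inf_{z\in E}|y-z|$. Let $(f,l)(t,x,a)\in\mathbb R^n\times\mathbb R$ be the Steiner point of $\Phi(t,x,a)$, where the Steiner point of a nonempty compact convex set $K\subset\mathbb R^{m}$ is $m\int p\,\max_{z\in K}\langle p,z\rangle\,\mu(dp)$, $\mu$ being the normalized surface measure of the unit sphere of $\mathbb R^m$. (The triple $(\mathbb B,f,l)$ is the constructed representation of $H$.) For $g:\mathbb R^n\to\mathbb R$, the value function associated with $(\mathbb B,f,l,g)$ is $$V(t_0,x_0)=\inf\Big\{g(x(T))+\int_{t_0}^Tl(t,x(t),a(t))\,dt\Big\},\qquad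 (t_0,x_0)\in[0,T]\times\mathbb R^n,$$ the infimum being over all pairs of an absolutely continuous $x:[t_0,T]\to\mathbb R^n$ and a measurable $a:[t_0,T]\to\mathbb R^{n+1}$ with $x(t_0)=x_0$, $a(t)\in\mathbb B$ and $\dot x(t)=f(t,x(t),a(t))$ for a.e. $t\in[t_0,T]$. **Corollary.** Let $(H_i,\lambda_i,k_{R\,i},c_i)$, $i\in\mathbb N$, and $(H,\lambda,k_R,c)$ satisfy the standing hypotheses, and let $g_i,g:\mathbb R^n\to\mathbb R$. Assume that $H_i,\lambda_i,k_{R\,i},c_i,g_i$ are continuous for every $i\in\mathbb N$ (and every $R>0$) and converge, as $i\to\infty$, uniformly on compact subsets of their domains to $H,\lambda,k_R,c,g$, respectively (for $k_R$: for every $R>0$). Let $V_i$ and $V$ be the value functions associated with $(\mathbb B,f_i,l_i,g_i)$ and $(\mathbb B,f,l,g)$, where $(f_i,l_i)$ and $(f,l)$ are built as above from $(H_i,\lambda_i,c_i)$ and $(H,\lambda,c)$. Then these value functions are well defined and finite (the running cost is integrable along every admissible pair, and the infimum is over a nonempty set of reals that is bounded below), and $V_i\to V$ uniformly on compact subsets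 of $[0,T]\times\mathbb R^n$. -/

import Mathlib

open Set Filter Topology MeasureTheory Metric

noncomputable section

/-- `F i → F₀` uniformly on compact subsets of `S`. -/
def TendstoUniformlyOnCompactsIn {X : Type*} [TopologicalSpace X]
    (F : ℕ → X → ℝ) (F₀ : X → ℝ) (S : Set X) : Prop :=
  ∀ K : Set X, K ⊆ S → IsCompact K → TendstoUniformlyOn F F₀ atTop K

/-- The Lagrangian: Legendre-Fenchel transform of the Hamiltonian in its last variable,
`L(t,x,v) = sup_p (⟨v,p⟩ - H(t,x,p))`, with values in the extended reals. -/
def lagrangian {n : ℕ}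
    (H : ℝ → EuclideanSpace ℝ (Fin n) → EuclideanSpace ℝ (Fin n) → ℝ)
    (t : ℝ) (x v : EuclideanSpace ℝ (Fin n)) : EReal :=
  ⨆ p : EuclideanSpace ℝ (Fin n), ((inner ℝ v p - H t x p : ℝ) : EReal)

/-- Standing hypotheses on a Hamiltonian `H` on `[0,T] × ℝⁿ × ℝⁿ`, with growth rate `c` and
Lipschitz rates `k R`, `R > 0`. Lebesgue measurability of a function on `[0,T]` is expressed as
a.e.-measurability with respect to Lebesgue measure restricted to `[0,T]`. -/
structure HamiltonianConditions {n : ℕ} (T : ℝ)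
    (H : ℝ → EuclideanSpace ℝ (Fin n) → EuclideanSpace ℝ (Fin n) → ℝ)
    (c : ℝ → ℝ) (k : ℝ → ℝ → ℝ) : Prop where
  measurable_time : ∀ x p, AEMeasurable (fun t => H t x p) (volume.restrict (Icc 0 T))
  continuous_state : ∀ t ∈ Icc 0 T,
    Continuous (fun z : EuclideanSpace ℝ (Fin n) × EuclideanSpace ℝ (Fin n) => H t z.1 z.2)
  convex : ∀ t ∈ Icc 0 T, ∀ x, ConvexOn ℝ univ (H t x)
  growth_measurable : AEMeasurable c (volume.restrict (Icc 0 T))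
  growth_nonneg : ∀ t ∈ Icc 0 T, 0 ≤ c t
  growth : ∀ t ∈ Icc 0 T, ∀ x p q, |H t x p - H t x q| ≤ c t * (1 + ‖x‖) * ‖p - q‖
  rate_measurable : ∀ R > 0, AEMeasurable (k R) (volume.restrict (Icc 0 T))
  rate_nonneg : ∀ R > 0, ∀ t ∈ Icc 0 T, 0 ≤ k R t
  lipschitz : ∀ R > 0, ∀ t ∈ Icc 0 T, ∀ x ∈ closedBall 0 R, ∀ y ∈ closedBall 0 R, ∀ p,
    |H t x p - H t y p| ≤ k R t * (1 + ‖p‖) * ‖x - y‖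

/-- The Lagrangian of `H` is bounded above on its effective domain by `lam`, which is measurable
in time, continuous in the state, and `k R t`-Lipschitz on the closed ball of radius `R`. -/
structure BoundedLagrangian {n : ℕ} (T : ℝ)
    (H : ℝ → EuclideanSpace ℝ (Fin n) → EuclideanSpace ℝ (Fin n) → ℝ)
    (lam : ℝ → EuclideanSpace ℝ (Fin n) → ℝ) (k : ℝ → ℝ → ℝ) : Prop where
  measurable_time : ∀ x, AEMeasurable (fun t => lam t x) (volume.restrict (Icc 0 T))
  continuous_state : ∀ t ∈ Icc 0 T, Continuous (lam t)
  bound : ∀ t ∈ Icc 0 T, ∀ x v, lagrangian H t x v ≠ ⊤ → lagrangian H t x v ≠ ⊥ →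
    lagrangian H t x v ≤ (lam t x : EReal)
  lipschitz : ∀ R > 0, ∀ t ∈ Icc 0 T, ∀ x ∈ closedBall 0 R, ∀ y ∈ closedBall 0 R,
    |lam t x - lam t y| ≤ k R t * ‖x - y‖

/-- First component of `z = (v, η) ∈ ℝⁿ × ℝ = ℝⁿ⁺¹`. -/
def proj₁ {n : ℕ} (z : EuclideanSpace ℝ (Fin (n + 1))) : EuclideanSpace ℝ (Fin n) :=
  WithLp.toLp 2 (fun j => z j.castSucc)

/-- Second component of `z = (v, η) ∈ ℝⁿ × ℝ = ℝⁿ⁺¹`. -/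
def proj₂ {n : ℕ} (z : EuclideanSpace ℝ (Fin (n + 1))) : ℝ := z (Fin.last n)

/-- The epigraph of `L(t,x,·)`, as a subset of `ℝⁿ⁺¹`. -/
def epiLagrangian {n : ℕ}
    (H : ℝ → EuclideanSpace ℝ (Fin n) → EuclideanSpace ℝ (Fin n) → ℝ)
    (t : ℝ) (x : EuclideanSpace ℝ (Fin n)) : Set (EuclideanSpace ℝ (Fin (n + 1))) :=
  {z | lagrangian H t x (proj₁ z) ≤ (proj₂ z : EReal)}

/-- The support function `σ(K,p) = max_{x ∈ K} ⟨p,x⟩` (of a nonempty compact set). -/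
def supportFunction {m : ℕ} (K : Set (EuclideanSpace ℝ (Fin m)))
    (p : EuclideanSpace ℝ (Fin m)) : ℝ :=
  sSup ((fun x => inner ℝ p x) '' K)

/-- The Steiner point `m ∫ p σ(K,p) μ(dp)`, where `μ` is the normalized surface measure of the
unit sphere of `ℝᵐ`; the integral against `μ` is written as the average `⨍` over the sphere. -/
def steinerPoint {m : ℕ} (K : Set (EuclideanSpace ℝ (Fin m))) : EuclideanSpace ℝ (Fin m) :=
  (m : ℝ) • ⨍ p : sphere (0 : EuclideanSpace ℝ (Fin m)) 1,
    supportFunction K (p : EuclideanSpace ℝ (Fin m)) • (p : EuclideanSpace ℝ (Fin m))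
      ∂(volume : Measure (EuclideanSpace ℝ (Fin m))).toSphere

/-- The set-valued map `P(y,K) = K ∩ B(y, 2 d(y,K))`. -/
def nearSet {m : ℕ} (y : EuclideanSpace ℝ (Fin m)) (K : Set (EuclideanSpace ℝ (Fin m))) :
    Set (EuclideanSpace ℝ (Fin m)) :=
  K ∩ closedBall y (2 * infDist y K)

/-- The scaling `ω(t,x) = |λ(t,x)| + |H(t,x,0)| + c(t)(1+|x|) + 1`. -/
def scaling {n : ℕ}
    (H : ℝ → EuclideanSpace ℝ (Fin n) → EuclideanSpace ℝ (Fin n) → ℝ)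
    (lam : ℝ → EuclideanSpace ℝ (Fin n) → ℝ) (c : ℝ → ℝ)
    (t : ℝ) (x : EuclideanSpace ℝ (Fin n)) : ℝ :=
  |lam t x| + |H t x 0| + c t * (1 + ‖x‖) + 1

/-- The epigraphical parametrization `e(t,x,a)`: the Steiner point of
`P(ω(t,x) a, epi L(t,x,·))`. -/
def epiParam {n : ℕ}
    (H : ℝ → EuclideanSpace ℝ (Fin n) → EuclideanSpace ℝ (Fin n) → ℝ)
    (lam : ℝ → EuclideanSpace ℝ (Fin n) → ℝ) (c : ℝ → ℝ)
    (t : ℝ) (x : EuclideanSpace ℝ (Fin n)) (a : EuclideanSpace ℝ (Fin (n + 1))) :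
    EuclideanSpace ℝ (Fin (n + 1)) :=
  steinerPoint (nearSet (scaling H lam c t x • a) (epiLagrangian H t x))

/-- The dynamics `f` of the constructed representation. -/
def repDynamics {n : ℕ}
    (H : ℝ → EuclideanSpace ℝ (Fin n) → EuclideanSpace ℝ (Fin n) → ℝ)
    (lam : ℝ → EuclideanSpace ℝ (Fin n) → ℝ) (c : ℝ → ℝ)
    (t : ℝ) (x : EuclideanSpace ℝ (Fin n)) (a : EuclideanSpace ℝ (Fin (n + 1))) :
    EuclideanSpace ℝ (Fin n) :=
  proj₁ (epiParam H lam c t x a)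

/-- The running cost `l` of the constructed representation. -/
def repCost {n : ℕ}
    (H : ℝ → EuclideanSpace ℝ (Fin n) → EuclideanSpace ℝ (Fin n) → ℝ)
    (lam : ℝ → EuclideanSpace ℝ (Fin n) → ℝ) (c : ℝ → ℝ)
    (t : ℝ) (x : EuclideanSpace ℝ (Fin n)) (a : EuclideanSpace ℝ (Fin (n + 1))) : ℝ :=
  proj₂ (epiParam H lam c t x a)

/-- `(x,a)` is a trajectory-control pair on `[t₀,T]` starting at `x₀` of the control system
`x' = f(t,x,a)`, `a ∈ A`: the control is Lebesgue measurable with values in `A` a.e., and the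
trajectory is absolutely continuous and solves the equation a.e. -/
structure IsTrajectoryControlPair {n m : ℕ}
    (f : ℝ → EuclideanSpace ℝ (Fin n) → EuclideanSpace ℝ (Fin m) → EuclideanSpace ℝ (Fin n))
    (A : Set (EuclideanSpace ℝ (Fin m))) (T t₀ : ℝ) (x₀ : EuclideanSpace ℝ (Fin n))
    (x : ℝ → EuclideanSpace ℝ (Fin n)) (a : ℝ → EuclideanSpace ℝ (Fin m)) : Prop where
  control_measurable : AEMeasurable a (volume.restrict (Icc t₀ T))
  control_mem : ∀ᵐ t ∂volume.restrict (Icc t₀ T), a t ∈ A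
  absolutelyContinuous : AbsolutelyContinuousOnInterval x t₀ T
  initial : x t₀ = x₀
  equation : ∀ᵐ t ∂volume.restrict (Icc t₀ T), HasDerivAt x (f t (x t) (a t)) t

/-- The values `g(x(T)) + ∫_{t₀}^T l(t,x(t),a(t)) dt` of the Bolza functional on all
trajectory-control pairs starting at `(t₀,x₀)`. -/
def bolzaCosts {n m : ℕ}
    (A : Set (EuclideanSpace ℝ (Fin m)))
    (f : ℝ → EuclideanSpace ℝ (Fin n) → EuclideanSpace ℝ (Fin m) → EuclideanSpace ℝ (Fin n))
    (l : ℝ → EuclideanSpace ℝ (Fin n) → EuclideanSpace ℝ (Fin m) → ℝ)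
    (g : EuclideanSpace ℝ (Fin n) → ℝ) (T t₀ : ℝ) (x₀ : EuclideanSpace ℝ (Fin n)) : Set ℝ :=
  {r | ∃ x a, IsTrajectoryControlPair f A T t₀ x₀ x a ∧
    r = g (x T) + ∫ t in t₀..T, l t (x t) (a t)}

/-- The value function `V(t₀,x₀)` associated with `(A,f,l,g)`. -/
def valueFunction {n m : ℕ}
    (A : Set (EuclideanSpace ℝ (Fin m)))
    (f : ℝ → EuclideanSpace ℝ (Fin n) → EuclideanSpace ℝ (Fin m) → EuclideanSpace ℝ (Fin n))
    (l : ℝ → EuclideanSpace ℝ (Fin n) → EuclideanSpace ℝ (Fin m) → ℝ)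
    (g : EuclideanSpace ℝ (Fin n) → ℝ) (T t₀ : ℝ) (x₀ : EuclideanSpace ℝ (Fin n)) : ℝ :=
  sInf (bolzaCosts A f l g T t₀ x₀)

/-- The value function associated with `(A,f,l,g)` is well defined and finite on `[0,T] × ℝⁿ`:
the running cost is integrable along every trajectory-control pair, and the infimum is taken over
a nonempty set that is bounded below. -/
def ValueWellDefined {n m : ℕ}
    (A : Set (EuclideanSpace ℝ (Fin m)))
    (f : ℝ → EuclideanSpace ℝ (Fin n) → EuclideanSpace ℝ (Fin m) → EuclideanSpace ℝ (Fin n))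
    (l : ℝ → EuclideanSpace ℝ (Fin n) → EuclideanSpace ℝ (Fin m) → ℝ)
    (g : EuclideanSpace ℝ (Fin n) → ℝ) (T : ℝ) : Prop :=
  ∀ t₀ ∈ Icc 0 T, ∀ x₀ : EuclideanSpace ℝ (Fin n),
    (∀ x a, IsTrajectoryControlPair f A T t₀ x₀ x a →
      IntervalIntegrable (fun t => l t (x t) (a t)) volume t₀ T) ∧
    (bolzaCosts A f l g T t₀ x₀).Nonempty ∧ BddBelow (bolzaCosts A f l g T t₀ x₀)

end

/-! ### Separation: linear minorants and subgradients -/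

section Convex

/-! Write e(t,x,a) = (f,l)(t,x,a). Two facts carry the convergence: e_i → e uniformly on [0,T] ×
(bounded sets) × 𝔹, and e is locally Lipschitz in x, uniformly in (t,a). Given these, feed the same
control to both systems: Grönwall's inequality bounds the distance between the trajectories, hence
between the costs, uniformly in the control, and the two infima differ by no more than that.

How e depends on H: if two convex functions differ by at most κ(1+|p|), then, by a Hahn-Banach
argument, the epigraphs of their conjugates are 2κ-close in the Hausdorff sense
(`exists_mem_conjEpi_dist_le`). The map (y,K) ↦ P(y,K) is Lipschitz with constant 10
(`exists_mem_nearSet_dist_le`), and the Steiner point in ℝⁿ⁺¹ is Lipschitz with constant n+1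
(`dist_steinerPoint_le`). The hypothesis on x-dependence already has the weighted form κ(1+|p|), so
e is Lipschitz in x. Convergence on compact sets controls bounded p only, and here the bound λ
enters: when conjugates are bounded on their domains, both functions are nearly homogeneous along
rays, so closeness on a large ball spreads to all p with the weight 1+|p|
(`abs_sub_le_of_conj_bounded`).

Well-posedness rests on the Steiner point belonging to its set (`steinerPoint_mem`). It makes
f(t,x,a) a point of the effective domain of L(t,x,·), whence |f| ≤ c(t)(1+|x|) and a priori bounds
on trajectories; Picard iteration then gives a trajectory for every control. Membership holds
because the Steiner point is a weighted mean of gradients of the support function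
(`inner_steinerPoint_le`). -/

theorem nonpos_of_forall_mul_le {A B : ℝ} (h : ∀ s : ℝ, 0 < s → s * A ≤ B) : A ≤ 0 := by
  by_contra! hA
  have := h ((|B| + 1) / A) (by positivity)
  rw [div_mul_cancel₀ _ hA.ne'] at this
  linarith [le_abs_self B]

/-- A convex function minorized by `-κ‖·‖` has a linear minorant of norm at most `κ`. -/
theorem ConvexOn.exists_linear_minorant {V : Type*} [NormedAddCommGroup V] [InnerProductSpace ℝ V]
    [CompleteSpace V] {φ : V → ℝ} (hφ : ConvexOn ℝ univ φ) {κ : ℝ} (hκ : 0 ≤ κ)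
    (h : ∀ p, -(κ * ‖p‖) ≤ φ p) : ∃ w : V, ‖w‖ ≤ κ ∧ ∀ p, inner ℝ w p ≤ φ p := by
  -- The open strict hypograph of -κ‖·‖, convex because κ ≥ 0, is to be separated from the epigraph
  -- of φ.
  have hs₁ : Convex ℝ {z : V × ℝ | z.2 < -(κ * ‖z.1‖)} := by
    intro z hz y hy a b ha hb hab
    simp only [mem_ofPred_eq, Prod.snd_add, Prod.smul_snd, Prod.fst_add, Prod.smul_fst,
      smul_eq_mul] at *
    have h1 : ‖a • z.1 + b • y.1‖ ≤ a * ‖z.1‖ + b * ‖y.1‖ := by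
      refine (norm_add_le _ _).trans ?_
      rw [norm_smul, norm_smul, Real.norm_of_nonneg ha, Real.norm_of_nonneg hb]
    have h2 : a * z.2 + b * y.2 < a * -(κ * ‖z.1‖) + b * -(κ * ‖y.1‖) := by
      rcases ha.eq_or_lt with rfl | ha'
      · have : b = 1 := by linarith
        subst this; linarith
      · have := mul_lt_mul_of_pos_left hz ha'
        have := mul_le_mul_of_nonneg_left hy.le hb
        linarith
    have := mul_le_mul_of_nonneg_left h1 hκ
    linarith
  have hs₂ : IsOpen {z : V × ℝ | z.2 < -(κ * ‖z.1‖)} :=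
    isOpen_lt (by fun_prop) (by fun_prop)
  have ht : Convex ℝ {z : V × ℝ | φ z.1 ≤ z.2} := by
    simpa using hφ.convex_epigraph
  have hdisj : Disjoint {z : V × ℝ | z.2 < -(κ * ‖z.1‖)} {z : V × ℝ | φ z.1 ≤ z.2} := by
    rw [Set.disjoint_left]
    intro z hz hz'
    simp only [mem_ofPred_eq] at hz hz'
    linarith [h z.1]
  obtain ⟨f, u, hfs, hft⟩ := geometric_hahn_banach_open hs₁ hs₂ ht hdisj
  have hsplit : ∀ (p : V) (r : ℝ), f (p, r) = f (p, 0) + r * f (0, 1) := by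
    intro p r
    have : ((p, r) : V × ℝ) = (p, 0) + r • ((0, 1) : V × ℝ) := by ext <;> simp
    rw [this, map_add, map_smul, smul_eq_mul]
  set β := f (0, 1) with hβ
  have hf0 : f ((0 : V), (0 : ℝ)) = 0 := by
    have : ((0 : V), (0 : ℝ)) = 0 := rfl
    rw [this, map_zero]
  have hφ0 : 0 ≤ φ 0 := by simpa using h 0
  -- The separating hyperplane is not vertical: the functional is below u at (0, -1), at least u at
  -- (0, φ 0), and φ 0 ≥ 0.
  have hβpos : 0 < β := by
    have h1 := hfs ((0 : V), (-1 : ℝ)) (by simp)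
    have h2 := hft ((0 : V), φ 0) (by simp)
    rw [hsplit, hf0] at h1 h2
    nlinarith
  let g : StrongDual ℝ V := f.comp (ContinuousLinearMap.inl ℝ V ℝ)
  set w : V := -(β⁻¹ • (InnerProductSpace.toDual ℝ V).symm g) with hw
  have hwp : ∀ p, f (p, 0) = -(β * inner ℝ w p) := by
    intro p
    rw [hw, inner_neg_left, real_inner_smul_left, InnerProductSpace.toDual_symm_apply]
    simp only [g, ContinuousLinearMap.comp_apply, ContinuousLinearMap.inl_apply]
    field_simp
  -- The level u / β lies between the two graphs tilted by w. At p = 0 the lower bound gives u / β ≥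
  -- 0, so ⟨w, p⟩ ≤ φ p; along p = -s w with s large it forces ‖w‖ ≤ κ.
  have hA : ∀ p, -(inner ℝ w p) - κ * ‖p‖ ≤ u / β := by
    intro p
    refine le_of_forall_pos_le_add fun ε hε => ?_
    have h1 := hfs (p, -(κ * ‖p‖) - ε) (by simp [hε])
    rw [hsplit, hwp] at h1
    have : (-(inner ℝ w p) - κ * ‖p‖ - ε) < u / β := by
      rw [lt_div_iff₀ hβpos]; linarith
    linarith
  have hB : ∀ p, u / β ≤ -(inner ℝ w p) + φ p := by
    intro p
    have h1 := hft (p, φ p) (by simp)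
    rw [hsplit, hwp] at h1
    rw [div_le_iff₀ hβpos]; linarith
  clear_value w
  refine ⟨w, ?_, fun p => ?_⟩
  · by_contra! hlt
    have : ‖w‖ * (‖w‖ - κ) ≤ 0 := by
      refine nonpos_of_forall_mul_le (B := u / β) fun s hs => ?_
      have := hA (-(s • w))
      rw [inner_neg_right, real_inner_smul_right, real_inner_self_eq_norm_sq, norm_neg,
        norm_smul s w, Real.norm_of_nonneg hs.le] at this
      linarith
    nlinarith [norm_nonneg w]
  · have h1 := hA 0
    have h2 := hB p
    simp only [inner_zero_right, norm_zero] at h1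
    linarith

/-- A convex function which is `C`-Lipschitz has a subgradient of norm at most `C`. -/
theorem ConvexOn.exists_subgradient {V : Type*} [NormedAddCommGroup V] [InnerProductSpace ℝ V]
    [CompleteSpace V] {h : V → ℝ} (hh : ConvexOn ℝ univ h) {C : ℝ} (hC : 0 ≤ C)
    (hlip : ∀ p q, |h p - h q| ≤ C * ‖p - q‖) (p : V) :
    ∃ w : V, ‖w‖ ≤ C ∧ ∀ q, h p + inner ℝ w (q - p) ≤ h q := by
  have hc : ConvexOn ℝ univ (fun q => h (p + q) - h p) := by
    have h1 : ConvexOn ℝ univ (fun q => h (p + q)) := by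
      simpa [Function.comp_def] using hh.translate_right p
    exact (h1.add_const (-h p)).congr fun q _ => by simp [sub_eq_add_neg]
  obtain ⟨w, hw, hwp⟩ := hc.exists_linear_minorant hC (fun q => by
    have := (abs_le.1 (hlip (p + q) p)).1
    simpa using this)
  refine ⟨w, hw, fun q => ?_⟩
  have := hwp (q - p)
  simp only [add_sub_cancel] at this
  linarith

end Convex

/-! ### Epigraphs of conjugates and their dependence on the function -/

section Epigraph

variable {n : ℕ}

/-- The point `(v, η)` of `ℝⁿ × ℝ = ℝⁿ⁺¹`. -/
noncomputable def mkPair (v : EuclideanSpace ℝ (Fin n)) (η : ℝ) : EuclideanSpace ℝ (Fin (n + 1)) :=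
  WithLp.toLp 2 (Fin.snoc (α := fun _ => ℝ) v.ofLp η)

@[simp] theorem proj₁_mkPair (v : EuclideanSpace ℝ (Fin n)) (η : ℝ) : proj₁ (mkPair v η) = v := by
  ext i; simp [proj₁, mkPair]

@[simp] theorem proj₂_mkPair (v : EuclideanSpace ℝ (Fin n)) (η : ℝ) : proj₂ (mkPair v η) = η := by
  simp [proj₂, mkPair]

theorem proj₁_add (z w : EuclideanSpace ℝ (Fin (n + 1))) : proj₁ (z + w) = proj₁ z + proj₁ w := by
  ext i; simp [proj₁]

theorem proj₁_sub (z w : EuclideanSpace ℝ (Fin (n + 1))) : proj₁ (z - w) = proj₁ z - proj₁ w := by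
  ext i; simp [proj₁]

theorem proj₁_smul (a : ℝ) (z : EuclideanSpace ℝ (Fin (n + 1))) :
    proj₁ (a • z) = a • proj₁ z := by
  ext i; simp [proj₁]

theorem proj₂_add (z w : EuclideanSpace ℝ (Fin (n + 1))) : proj₂ (z + w) = proj₂ z + proj₂ w := by
  simp [proj₂]

theorem proj₂_sub (z w : EuclideanSpace ℝ (Fin (n + 1))) : proj₂ (z - w) = proj₂ z - proj₂ w := by
  simp [proj₂]

theorem proj₂_smul (a : ℝ) (z : EuclideanSpace ℝ (Fin (n + 1))) :
    proj₂ (a • z) = a * proj₂ z := by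
  simp [proj₂]

theorem norm_sq_eq_proj (z : EuclideanSpace ℝ (Fin (n + 1))) :
    ‖z‖ ^ 2 = ‖proj₁ z‖ ^ 2 + proj₂ z ^ 2 := by
  simp [EuclideanSpace.norm_sq_eq, Fin.sum_univ_castSucc, proj₁, proj₂]

theorem norm_le_proj (z : EuclideanSpace ℝ (Fin (n + 1))) : ‖z‖ ≤ ‖proj₁ z‖ + |proj₂ z| := by
  refine abs_le_of_sq_le_sq' ?_ (by positivity) |>.2
  rw [norm_sq_eq_proj, ← sq_abs (proj₂ z)]
  nlinarith [mul_nonneg (norm_nonneg (proj₁ z)) (abs_nonneg (proj₂ z))]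

theorem norm_proj₁_le (z : EuclideanSpace ℝ (Fin (n + 1))) : ‖proj₁ z‖ ≤ ‖z‖ := by
  refine abs_le_of_sq_le_sq' ?_ (by positivity) |>.2
  rw [norm_sq_eq_proj z]; nlinarith [sq_nonneg (proj₂ z)]

theorem abs_proj₂_le (z : EuclideanSpace ℝ (Fin (n + 1))) : |proj₂ z| ≤ ‖z‖ := by
  refine abs_le_of_sq_le_sq' ?_ (by positivity) |>.2
  rw [norm_sq_eq_proj z, sq_abs]; nlinarith [sq_nonneg (‖proj₁ z‖)]

theorem continuous_proj₁ : Continuous (proj₁ : EuclideanSpace ℝ (Fin (n + 1)) → _) := by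
  unfold proj₁; fun_prop

theorem continuous_proj₂ : Continuous (proj₂ : EuclideanSpace ℝ (Fin (n + 1)) → _) := by
  unfold proj₂; fun_prop

/-- The epigraph of the Legendre-Fenchel transform of `h`. -/
def conjEpi (h : EuclideanSpace ℝ (Fin n) → ℝ) : Set (EuclideanSpace ℝ (Fin (n + 1))) :=
  {z | ∀ p, inner ℝ (proj₁ z) p - h p ≤ proj₂ z}

theorem epiLagrangian_eq_conjEpi
    (H : ℝ → EuclideanSpace ℝ (Fin n) → EuclideanSpace ℝ (Fin n) → ℝ) (t : ℝ)
    (x : EuclideanSpace ℝ (Fin n)) : epiLagrangian H t x = conjEpi (H t x) := by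
  ext z
  simp only [epiLagrangian, conjEpi, lagrangian, mem_ofPred_eq, iSup_le_iff, EReal.coe_le_coe_iff]

theorem isClosed_conjEpi (h : EuclideanSpace ℝ (Fin n) → ℝ) : IsClosed (conjEpi h) := by
  have : conjEpi h = ⋂ p, {z | inner ℝ (proj₁ z) p - h p ≤ proj₂ z} := by
    ext z; simp [conjEpi]
  rw [this]
  refine isClosed_iInter fun p => isClosed_le ?_ continuous_proj₂
  exact (continuous_proj₁.inner continuous_const).sub continuous_const

theorem convex_conjEpi (h : EuclideanSpace ℝ (Fin n) → ℝ) : Convex ℝ (conjEpi h) := by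
  intro z hz w hw a b ha hb hab p
  rw [proj₁_add, proj₂_add, proj₁_smul, proj₁_smul, proj₂_smul, proj₂_smul, inner_add_left,
    real_inner_smul_left, real_inner_smul_left]
  have h1 := mul_le_mul_of_nonneg_left (hz p) ha
  have h2 := mul_le_mul_of_nonneg_left (hw p) hb
  have : h p = a * h p + b * h p := by rw [← add_mul, hab, one_mul]
  linarith

theorem mkPair_mem_conjEpi {h : EuclideanSpace ℝ (Fin n) → ℝ} {v p : EuclideanSpace ℝ (Fin n)}
    (hv : ∀ q, h p + inner ℝ v (q - p) ≤ h q) : mkPair v (inner ℝ v p - h p) ∈ conjEpi h := by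
  intro q
  have := hv q
  rw [inner_sub_right] at this
  simp only [proj₁_mkPair, proj₂_mkPair]
  linarith

/-- Testing with p = s v, the term s‖v‖² would outgrow the Lipschitz bound C s‖v‖ as s → ∞ if ‖v‖ >
C. -/
theorem norm_proj₁_le_of_mem_conjEpi {h : EuclideanSpace ℝ (Fin n) → ℝ} {C : ℝ} (hC : 0 ≤ C)
    (hlip : ∀ p q, |h p - h q| ≤ C * ‖p - q‖) {z : EuclideanSpace ℝ (Fin (n + 1))}
    (hz : z ∈ conjEpi h) : ‖proj₁ z‖ ≤ C := by
  by_contra! hlt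
  have : ‖proj₁ z‖ * (‖proj₁ z‖ - C) ≤ 0 := by
    refine nonpos_of_forall_mul_le (B := h 0 + proj₂ z) fun s hs => ?_
    have h1 := hz (s • proj₁ z)
    have h2 := (abs_le.1 (hlip (s • proj₁ z) 0)).2
    rw [real_inner_smul_right, real_inner_self_eq_norm_sq] at h1
    rw [sub_zero, norm_smul s, Real.norm_of_nonneg hs.le] at h2
    linarith
  nlinarith [norm_nonneg (proj₁ z)]

/-- Closeness of convex functions relative to `1 + ‖·‖` gives closeness of the epigraphs of their
conjugates. -/
theorem exists_mem_conjEpi_dist_le {h₁ h₂ : EuclideanSpace ℝ (Fin n) → ℝ}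
    (hc : ConvexOn ℝ univ h₂) {κ : ℝ} (hκ : 0 ≤ κ) (hle : ∀ p, |h₁ p - h₂ p| ≤ κ * (1 + ‖p‖))
    {z : EuclideanSpace ℝ (Fin (n + 1))} (hz : z ∈ conjEpi h₁) :
    ∃ z' ∈ conjEpi h₂, dist z z' ≤ 2 * κ := by
  -- For z = (v, η) this function is at least -κ‖p‖. A linear minorant w of it says exactly that (v
  -- + w, η + κ) lies in the epigraph of the conjugate of h₂.
  have hφ : ConvexOn ℝ univ (fun p => h₂ p + (proj₂ z + κ - inner ℝ (proj₁ z) p)) := by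
    refine hc.add ?_
    have : ConvexOn ℝ univ (fun p => (-(innerSL ℝ (proj₁ z))) p) :=
      (-(innerSL ℝ (proj₁ z))).toLinearMap.convexOn convex_univ
    have := this.add_const (proj₂ z + κ)
    refine this.congr fun p _ => ?_
    simp only [neg_apply, innerSL_apply_apply, Pi.add_apply]
    ring
  obtain ⟨w, hw, hwp⟩ := hφ.exists_linear_minorant hκ (fun p => by
    have h1 := (abs_le.1 (hle p)).2
    have h2 := hz p
    linarith)
  refine ⟨mkPair (proj₁ z + w) (proj₂ z + κ), fun p => ?_, ?_⟩
  · have := hwp p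
    simp only [proj₁_mkPair, proj₂_mkPair, inner_add_left]
    linarith
  · rw [dist_eq_norm]
    refine (norm_le_proj _).trans ?_
    rw [proj₁_sub, proj₂_sub, proj₁_mkPair, proj₂_mkPair, sub_add_cancel_left, sub_add_cancel_left,
      norm_neg, abs_neg, abs_of_nonneg hκ]
    linarith

/-- If the conjugates of two convex Lipschitz functions are bounded by `M` on their domains, then
closeness of the functions on a large ball gives closeness relative to `1 + ‖·‖`. -/
theorem abs_sub_le_of_conj_bounded {h₁ h₂ : EuclideanSpace ℝ (Fin n) → ℝ}
    (hc₁ : ConvexOn ℝ univ h₁) (hc₂ : ConvexOn ℝ univ h₂) {C : ℝ} (hC : 0 ≤ C)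
    (hl₁ : ∀ p q, |h₁ p - h₁ q| ≤ C * ‖p - q‖) (hl₂ : ∀ p q, |h₂ p - h₂ q| ≤ C * ‖p - q‖)
    {M : ℝ}
    (hM₁ : ∀ v p, (∀ q, h₁ p + inner ℝ v (q - p) ≤ h₁ q) → |inner ℝ v p - h₁ p| ≤ M)
    (hM₂ : ∀ v p, (∀ q, h₂ p + inner ℝ v (q - p) ≤ h₂ q) → |inner ℝ v p - h₂ p| ≤ M)
    {P ε κ : ℝ} (hP : 0 < P) (hε : ∀ p, ‖p‖ ≤ P → |h₁ p - h₂ p| ≤ ε) (hεκ : ε ≤ κ)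
    (hκ : ε + 4 * M ≤ κ * P) (p : EuclideanSpace ℝ (Fin n)) :
    |h₁ p - h₂ p| ≤ κ * (1 + ‖p‖) := by
  have key : ∀ {h₁ h₂ : EuclideanSpace ℝ (Fin n) → ℝ},
      ConvexOn ℝ univ h₁ → ConvexOn ℝ univ h₂ →
      (∀ p q, |h₁ p - h₁ q| ≤ C * ‖p - q‖) → (∀ p q, |h₂ p - h₂ q| ≤ C * ‖p - q‖) →
      (∀ v p, (∀ q, h₁ p + inner ℝ v (q - p) ≤ h₁ q) → |inner ℝ v p - h₁ p| ≤ M) →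
      (∀ v p, (∀ q, h₂ p + inner ℝ v (q - p) ≤ h₂ q) → |inner ℝ v p - h₂ p| ≤ M) →
      (∀ p, ‖p‖ ≤ P → |h₁ p - h₂ p| ≤ ε) → ∀ p, P ≤ ‖p‖ → h₁ p - h₂ p ≤ κ * ‖p‖ := by
    intro h₁ h₂ hc₁ hc₂ hl₁ hl₂ hM₁ hM₂ hε p hp
    have hp0 : 0 < ‖p‖ := hP.trans_le hp
    set s := ‖p‖ / P with hs
    have hs1 : 1 ≤ s := (one_le_div hP).2 hp
    have hs0 : 0 < s := by positivity
    set q := s⁻¹ • p with hq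
    have hpq : p = s • q := by rw [hq, smul_smul, mul_inv_cancel₀ hs0.ne', one_smul]
    have hqn : ‖q‖ = P := by
      rw [hq, norm_smul, norm_inv, Real.norm_of_nonneg hs0.le, hs]; field_simp
    -- At a subgradient v of h₁ at p, ⟨v, p⟩ - h₁ p is the conjugate value at v, so it is at most M
    -- in absolute value. With p = s q and ‖q‖ = P, this yields h₁ p ≤ s (h₁ q + M) + M. The
    -- subgradient u of h₂ at q yields h₂ p ≥ s (h₂ q - M) - M. As s ≥ 1, the total error is at most
    -- s (ε + 4M).
    obtain ⟨v, -, hv⟩ := hc₁.exists_subgradient hC hl₁ p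
    obtain ⟨u, -, hu⟩ := hc₂.exists_subgradient hC hl₂ q
    have h1 := abs_le.1 (hM₁ v p hv)
    have h2 := abs_le.1 (hM₂ u q hu)
    have h3 := hv q
    have h4 := hu p
    have h5 := (abs_le.1 (hε q hqn.le)).2
    rw [inner_sub_right] at h3 h4
    have h6 : inner ℝ v p = s * inner ℝ v q := by
      nth_rw 1 [hpq]; rw [real_inner_smul_right]
    have h7 : inner ℝ u p = s * inner ℝ u q := by
      nth_rw 1 [hpq]; rw [real_inner_smul_right]
    have hM : 0 ≤ M := (abs_nonneg _).trans (hM₁ v p hv)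
    have h8 : h₁ p - h₂ p ≤ s * (ε + 4 * M) := by
      have a1 : h₁ p ≤ s * inner ℝ v q + M := by linarith
      have a2 : s * inner ℝ v q ≤ s * (h₁ q + M) :=
        mul_le_mul_of_nonneg_left (by linarith) hs0.le
      have a3 : s * (h₂ q - M) ≤ s * inner ℝ u q :=
        mul_le_mul_of_nonneg_left (by linarith) hs0.le
      have a4 : s * inner ℝ u q - M ≤ h₂ p := by linarith
      have a5 : s * (h₁ q - h₂ q) ≤ s * ε := mul_le_mul_of_nonneg_left h5 hs0.le
      nlinarith
    calc h₁ p - h₂ p ≤ s * (ε + 4 * M) := h8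
      _ ≤ s * (κ * P) := mul_le_mul_of_nonneg_left hκ hs0.le
      _ = κ * ‖p‖ := by rw [hs]; field_simp
  have hκ0 : 0 ≤ κ := ((abs_nonneg _).trans (hε 0 (by simpa using hP.le))).trans hεκ
  rcases le_total ‖p‖ P with hp | hp
  · have := hε p hp
    nlinarith [mul_nonneg hκ0 (norm_nonneg p)]
  · have k1 := key hc₁ hc₂ hl₁ hl₂ hM₁ hM₂ hε p hp
    have k2 := key hc₂ hc₁ hl₂ hl₁ hM₂ hM₁ (fun p hp => abs_sub_comm (h₁ p) _ ▸ hε p hp) p hp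
    rw [abs_le]
    constructor <;> linarith

end Epigraph

/-! ### Lipschitz dependence of the intersection with a ball of twice the distance -/

section NearSet

variable {m : ℕ}

theorem isCompact_nearSet (y : EuclideanSpace ℝ (Fin m)) {K : Set (EuclideanSpace ℝ (Fin m))}
    (hK : IsClosed K) : IsCompact (nearSet y K) :=
  (isCompact_closedBall _ _).inter_left hK

theorem convex_nearSet (y : EuclideanSpace ℝ (Fin m)) {K : Set (EuclideanSpace ℝ (Fin m))}
    (hK : Convex ℝ K) : Convex ℝ (nearSet y K) :=
  hK.inter (convex_closedBall _ _)

theorem nonempty_nearSet (y : EuclideanSpace ℝ (Fin m)) {K : Set (EuclideanSpace ℝ (Fin m))}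
    (hK : IsClosed K) (hne : K.Nonempty) : (nearSet y K).Nonempty := by
  obtain ⟨z, hz, hd⟩ := hK.exists_infDist_eq_dist hne y
  refine ⟨z, hz, ?_⟩
  rw [mem_closedBall, dist_comm, ← hd]
  linarith [infDist_nonneg (x := y) (s := K)]

theorem infDist_le_infDist_add {K D : Set (EuclideanSpace ℝ (Fin m))} (hK : K.Nonempty) {h : ℝ}
    (hKD : ∀ z ∈ K, ∃ z' ∈ D, dist z z' ≤ h) (x y : EuclideanSpace ℝ (Fin m)) :
    infDist y D ≤ infDist x K + (h + dist x y) := by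
  refine le_of_forall_pos_le_add fun ε hε => ?_
  obtain ⟨z, hz, hzx⟩ := (infDist_lt_iff hK).1 (lt_add_of_pos_right (infDist x K) hε)
  obtain ⟨z', hz', hd⟩ := hKD z hz
  have h1 := infDist_le_dist_of_mem (x := y) hz'
  have h2 := dist_triangle4 y x z z'
  rw [dist_comm y x] at h2
  linarith

/-- The map `(y, K) ↦ P(y, K)` is Lipschitz for the Hausdorff distance. -/
theorem exists_mem_nearSet_dist_le {K D : Set (EuclideanSpace ℝ (Fin m))}
    (hDne : D.Nonempty) (hDc : IsClosed D) (hD : Convex ℝ D) {h : ℝ} (h0 : 0 ≤ h)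
    (hKD : ∀ z ∈ K, ∃ z' ∈ D, dist z z' ≤ h) (hDK : ∀ z ∈ D, ∃ z' ∈ K, dist z z' ≤ h)
    (x y : EuclideanSpace ℝ (Fin m)) {z : EuclideanSpace ℝ (Fin m)} (hz : z ∈ nearSet x K) :
    ∃ z' ∈ nearSet y D, dist z z' ≤ 10 * (h + dist x y) := by
  set ρ := h + dist x y with hρ
  have hρ0 : 0 ≤ ρ := add_nonneg h0 dist_nonneg
  set d' := infDist y D with hd'
  have hd0 : 0 ≤ d' := infDist_nonneg
  have hdd : infDist x K ≤ d' + ρ := by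
    have := infDist_le_infDist_add hDne hDK y x
    rwa [dist_comm y x] at this
  obtain ⟨hzK, hzx⟩ := hz
  rw [mem_closedBall] at hzx
  obtain ⟨z₁, hz₁, hzz₁⟩ := hKD z hzK
  obtain ⟨π, hπ, hdπ⟩ := hDc.exists_infDist_eq_dist hDne y
  have hz₁y : dist z₁ y ≤ 2 * d' + 3 * ρ := by
    have := dist_triangle4 z₁ z x y
    rw [dist_comm z₁ z] at this
    linarith
  have hz₁π : dist z₁ π ≤ 3 * d' + 3 * ρ := by
    have := dist_triangle z₁ y π
    linarith
  -- The point z₁ of `D` may lie outside the ball of radius 2d' by up to 3ρ, while the projection π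
  -- of y is at distance d'. Moving from z₁ towards π by this fraction gives (1-θ)(2d'+3ρ) + θd' =
  -- 2d', and the displacement θ(3d'+3ρ) is at most 9ρ.
  set θ := 3 * ρ / (d' + 3 * ρ) with hθ
  have hθ0 : 0 ≤ θ := by positivity
  have hθ1 : θ ≤ 1 := div_le_one_of_le₀ (by linarith) (by positivity)
  -- A vanishing denominator is harmless: then ρ = 0 and both sides are 0.
  have hθm : θ * (d' + 3 * ρ) = 3 * ρ := by
    rcases (show 0 ≤ d' + 3 * ρ by positivity).eq_or_lt with h | h
    · rw [← h, mul_zero]; linarith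
    · rw [hθ, div_mul_cancel₀ _ h.ne']
  refine ⟨(1 - θ) • z₁ + θ • π, ⟨hD hz₁ hπ (by linarith) hθ0 (by ring), ?_⟩, ?_⟩
  · rw [mem_closedBall, dist_eq_norm]
    have : (1 - θ) • z₁ + θ • π - y = (1 - θ) • (z₁ - y) + θ • (π - y) := by module
    rw [this]
    refine (norm_add_le _ _).trans ?_
    rw [norm_smul, norm_smul, Real.norm_of_nonneg hθ0, Real.norm_of_nonneg (by linarith),
      ← dist_eq_norm, ← dist_eq_norm, dist_comm π, ← hdπ]
    have := mul_le_mul_of_nonneg_left hz₁y (show 0 ≤ 1 - θ by linarith)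
    nlinarith
  · have h1 : dist z₁ ((1 - θ) • z₁ + θ • π) ≤ θ * (3 * d' + 3 * ρ) := by
      rw [dist_eq_norm]
      have : z₁ - ((1 - θ) • z₁ + θ • π) = θ • (z₁ - π) := by module
      rw [this, norm_smul, Real.norm_of_nonneg hθ0, ← dist_eq_norm]
      exact mul_le_mul_of_nonneg_left hz₁π hθ0
    have h2 := dist_triangle z z₁ ((1 - θ) • z₁ + θ • π)
    have h3 : 0 ≤ dist x y := dist_nonneg
    nlinarith [mul_nonneg hθ0 hρ0]

end NearSet

/-! ### Support functions and the Steiner point -/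

section SupportFunction

variable {m : ℕ} {K D : Set (EuclideanSpace ℝ (Fin m))}

theorem inner_le_supportFunction (hK : IsCompact K) (p : EuclideanSpace ℝ (Fin m))
    {x : EuclideanSpace ℝ (Fin m)} (hx : x ∈ K) : inner ℝ p x ≤ supportFunction K p :=
  le_csSup (hK.image (by fun_prop)).bddAbove (mem_image_of_mem _ hx)

theorem supportFunction_le (hne : K.Nonempty) {p : EuclideanSpace ℝ (Fin m)} {b : ℝ}
    (h : ∀ x ∈ K, inner ℝ p x ≤ b) : supportFunction K p ≤ b :=
  csSup_le (hne.image _) (forall_mem_image.2 h)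

theorem supportFunction_add_le (hK : IsCompact K) (hne : K.Nonempty)
    (p q : EuclideanSpace ℝ (Fin m)) :
    supportFunction K (p + q) ≤ supportFunction K p + supportFunction K q :=
  supportFunction_le hne fun x hx => by
    rw [inner_add_left]
    exact add_le_add (inner_le_supportFunction hK p hx) (inner_le_supportFunction hK q hx)

theorem supportFunction_smul {s : ℝ} (hs : 0 ≤ s) (p : EuclideanSpace ℝ (Fin m)) :
    supportFunction K (s • p) = s * supportFunction K p := by
  unfold supportFunction
  rw [← smul_eq_mul, ← Real.sSup_smul_of_nonneg hs]
  congr 1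
  ext y
  simp [Set.mem_smul_set, real_inner_smul_left]

theorem lipschitzWith_supportFunction (hK : IsCompact K) (hne : K.Nonempty) :
    ∃ C, LipschitzWith C (supportFunction K) := by
  obtain ⟨R, hR⟩ := hK.isBounded.subset_closedBall (0 : EuclideanSpace ℝ (Fin m))
  have hb : ∀ p, supportFunction K p ≤ (max R 0) * ‖p‖ := fun p =>
    supportFunction_le hne fun x hx => by
      have h1 := real_inner_le_norm p x
      have h2 : ‖x‖ ≤ max R 0 := (mem_closedBall_zero_iff.1 (hR hx)).trans (le_max_left _ _)
      nlinarith [norm_nonneg p]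
  refine ⟨⟨max R 0, le_max_right _ _⟩, LipschitzWith.of_le_add_mul _ fun p q => ?_⟩
  have h1 := supportFunction_add_le hK hne q (p - q)
  rw [add_sub_cancel] at h1
  have h2 := hb (p - q)
  rw [dist_eq_norm]
  exact h1.trans (by gcongr; exact h2)

theorem continuous_supportFunction (hK : IsCompact K) (hne : K.Nonempty) :
    Continuous (supportFunction K) :=
  let ⟨_, hC⟩ := lipschitzWith_supportFunction hK hne
  hC.continuous

theorem supportFunction_le_add (hne : K.Nonempty) (hD : IsCompact D) {ρ : ℝ}
    (h : ∀ z ∈ K, ∃ z' ∈ D, dist z z' ≤ ρ) (p : EuclideanSpace ℝ (Fin m)) :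
    supportFunction K p ≤ supportFunction D p + ρ * ‖p‖ :=
  supportFunction_le hne fun x hx => by
    obtain ⟨z, hz, hxz⟩ := h x hx
    have h1 := inner_le_supportFunction hD p hz
    have h2 := real_inner_le_norm p (x - z)
    rw [inner_sub_right] at h2
    rw [dist_eq_norm] at hxz
    nlinarith [norm_nonneg p]

theorem integrable_supportFunction_smul (hK : IsCompact K) (hne : K.Nonempty) :
    Integrable (fun p : sphere (0 : EuclideanSpace ℝ (Fin m)) 1 =>
      supportFunction K (p : EuclideanSpace ℝ (Fin m)) • (p : EuclideanSpace ℝ (Fin m)))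
      (volume : Measure (EuclideanSpace ℝ (Fin m))).toSphere :=
  Continuous.integrable_of_hasCompactSupport
    (((continuous_supportFunction hK hne).comp continuous_subtype_val).smul continuous_subtype_val)
    (HasCompactSupport.of_compactSpace _)

/-- The Steiner point is Lipschitz for the Hausdorff distance. -/
theorem dist_steinerPoint_le (hK : IsCompact K) (hKne : K.Nonempty) (hD : IsCompact D)
    (hDne : D.Nonempty) {ρ : ℝ} (hρ : 0 ≤ ρ) (hKD : ∀ z ∈ K, ∃ z' ∈ D, dist z z' ≤ ρ)
    (hDK : ∀ z ∈ D, ∃ z' ∈ K, dist z z' ≤ ρ) :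
    dist (steinerPoint K) (steinerPoint D) ≤ m * ρ := by
  rw [dist_eq_norm, steinerPoint, steinerPoint, ← smul_sub, norm_smul, Real.norm_natCast]
  refine mul_le_mul_of_nonneg_left ?_ (Nat.cast_nonneg _)
  rw [average_eq, average_eq, ← smul_sub, ← integral_sub (integrable_supportFunction_smul hK hKne)
    (integrable_supportFunction_smul hD hDne), norm_smul, norm_inv,
    Real.norm_of_nonneg measureReal_nonneg]
  have h1 := norm_integral_le_of_norm_le_const
    (μ := (volume : Measure (EuclideanSpace ℝ (Fin m))).toSphere) (C := ρ)
    (f := fun p : sphere (0 : EuclideanSpace ℝ (Fin m)) 1 =>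
      supportFunction K (p : EuclideanSpace ℝ (Fin m)) • (p : EuclideanSpace ℝ (Fin m)) -
      supportFunction D (p : EuclideanSpace ℝ (Fin m)) • (p : EuclideanSpace ℝ (Fin m)))
    (Eventually.of_forall fun p => by
      have hp : ‖(p : EuclideanSpace ℝ (Fin m))‖ = 1 := norm_eq_of_mem_sphere p
      rw [← sub_smul, norm_smul, hp, mul_one, Real.norm_eq_abs, abs_le]
      have a1 := supportFunction_le_add hKne hD hKD p
      have a2 := supportFunction_le_add hDne hK hDK p
      rw [hp] at a1 a2
      constructor <;> linarith)
  rw [inv_mul_eq_div]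
  exact div_le_of_le_mul₀ measureReal_nonneg hρ h1

/-- Polar coordinates for products of an angular and a radial function. -/
theorem integral_eq_mul_of_polar {V : Type*} [NormedAddCommGroup V] [NormedSpace ℝ V]
    [FiniteDimensional ℝ V] [MeasurableSpace V] [BorelSpace V] [Nontrivial V]
    (μ : Measure V) [μ.IsAddHaarMeasure] {F : V → ℝ} {A : sphere (0 : V) 1 → ℝ} {B : ℝ → ℝ}
    (h : ∀ (p : sphere (0 : V) 1) (r : ℝ), 0 < r → F (r • (p : V)) = A p * B r) :
    ∫ x, F x ∂μ = (∫ p, A p ∂μ.toSphere) *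
      ∫ r in Ioi (0 : ℝ), r ^ (Module.finrank ℝ V - 1) * B r := by
  calc ∫ x, F x ∂μ = ∫ x : ({(0)}ᶜ : Set V), F x.1 ∂(μ.comap (↑)) := by
        rw [integral_subtype_comap (measurableSet_singleton _).compl fun x ↦ F x,
          restrict_compl_singleton]
    _ = ∫ x, A x.1 * B x.2 ∂μ.toSphere.prod (.volumeIoiPow (Module.finrank ℝ V - 1)) := by
        rw [← μ.measurePreserving_homeomorphUnitSphereProd.integral_comp
          (Homeomorph.measurableEmbedding _) (fun x : sphere (0 : V) 1 × Ioi (0 : ℝ) =>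
            A x.1 * B x.2)]
        refine integral_congr_ae (Eventually.of_forall fun x => ?_)
        obtain ⟨y, rfl⟩ := (homeomorphUnitSphereProd V).symm.surjective x
        simp only [Homeomorph.apply_symm_apply, homeomorphUnitSphereProd_symm_apply_coe]
        exact h y.1 y.2 y.2.2
    _ = (∫ p, A p ∂μ.toSphere) *
        ∫ x, B (x : ℝ) ∂(Measure.volumeIoiPow (Module.finrank ℝ V - 1)) :=
        integral_prod_mul A fun x : Ioi (0 : ℝ) => B x
    _ = _ := by
        congr 1
        simp only [Measure.volumeIoiPow, ENNReal.ofReal]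
        rw [integral_withDensity_eq_integral_smul, integral_subtype_comap measurableSet_Ioi
          fun a ↦ Real.toNNReal (a ^ (Module.finrank ℝ V - 1)) • B a]
        · refine setIntegral_congr_fun measurableSet_Ioi fun a ha => ?_
          rw [NNReal.smul_def, Real.coe_toNNReal _ (pow_nonneg (mem_Ioi.1 ha).le _), smul_eq_mul]
        · exact (measurable_subtype_coe.pow_const _).real_toNNReal

theorem setIntegral_Ioi_mul_indicator (B : ℝ → ℝ) (d : ℕ) :
    ∫ r in Ioi (0 : ℝ), r ^ d * (Iio (1 : ℝ)).indicator B r = ∫ r in (0 : ℝ)..1, r ^ d * B r := by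
  rw [intervalIntegral.integral_of_le zero_le_one, integral_Ioc_eq_integral_Ioo,
    ← Ioi_inter_Iio, ← setIntegral_indicator measurableSet_Iio]
  refine setIntegral_congr_fun measurableSet_Ioi fun r _ => ?_
  by_cases hr : r ∈ Iio (1 : ℝ) <;> simp [hr]

/-- The bump `(1 - ‖x‖²)₊`. -/
noncomputable def quadBump (x : EuclideanSpace ℝ (Fin m)) : ℝ :=
  max 0 (1 - ‖x‖ ^ 2)

theorem lipschitzWith_quadBump :
    LipschitzWith 2 (quadBump : EuclideanSpace ℝ (Fin m) → ℝ) := by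
  refine LipschitzWith.of_le_add_mul _ fun x y => ?_
  have hd := dist_nonneg (x := x) (y := y)
  have h1 : ‖y‖ ≤ ‖x‖ + dist x y := by
    rw [dist_comm, dist_eq_norm]; linarith [norm_sub_norm_le y x]
  refine max_le (add_nonneg (le_max_left _ _) (by positivity)) ?_
  unfold quadBump
  rcases le_total ‖y‖ 1 with hy | hy
  · have := le_max_right 0 (1 - ‖y‖ ^ 2)
    push_cast
    rcases le_total ‖y‖ ‖x‖ with hxy | hxy
    · nlinarith [norm_nonneg y]
    · nlinarith [norm_nonneg x, norm_nonneg y]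
  · have := le_max_left 0 (1 - ‖y‖ ^ 2)
    push_cast
    rcases le_total 1 ‖x‖ with hx | hx
    · nlinarith
    · nlinarith [norm_nonneg x]

theorem hasCompactSupport_quadBump :
    HasCompactSupport (quadBump : EuclideanSpace ℝ (Fin m) → ℝ) := by
  refine HasCompactSupport.intro (isCompact_closedBall 0 1) fun x hx => ?_
  rw [mem_closedBall_zero_iff, not_le] at hx
  exact max_eq_left (by nlinarith)

theorem lineDeriv_quadBump {x : EuclideanSpace ℝ (Fin m)} (hx : ‖x‖ ≠ 1)
    (v : EuclideanSpace ℝ (Fin m)) :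
    lineDeriv ℝ quadBump x v = if ‖x‖ < 1 then -2 * inner ℝ x v else 0 := by
  have hev : ∀ {f : EuclideanSpace ℝ (Fin m) → ℝ}, quadBump =ᶠ[𝓝 x] f →
      lineDeriv ℝ quadBump x v = lineDeriv ℝ f x v := fun h => h.lineDeriv_eq
  split_ifs with h
  · have h1 : quadBump =ᶠ[𝓝 x] fun y => 1 - ‖y‖ ^ 2 := by
      filter_upwards [(isOpen_lt continuous_norm continuous_const).mem_nhds h] with y hy
      have hy' : ‖y‖ < 1 := hy
      exact max_eq_right (by nlinarith [norm_nonneg y])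
    rw [hev h1]
    have h2 : HasFDerivAt (fun y : EuclideanSpace ℝ (Fin m) => 1 - ‖y‖ ^ 2)
        (-(2 • innerSL ℝ x)) x := by
      exact (hasStrictFDerivAt_norm_sq x).hasFDerivAt.const_sub 1
    rw [(h2.hasLineDerivAt v).lineDeriv]
    simp [two_mul]
  · have h' : 1 < ‖x‖ := lt_of_le_of_ne (not_lt.1 h) hx.symm
    have h1 : quadBump =ᶠ[𝓝 x] fun y => 0 := by
      filter_upwards [(isOpen_lt continuous_const continuous_norm).mem_nhds h'] with y hy
      have hy' : 1 < ‖y‖ := hy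
      exact max_eq_left (by nlinarith)
    rw [hev h1]
    simp [lineDeriv]

/-- By sublinearity, every difference quotient with t > 0 is already at most σ(v). -/
theorem lineDeriv_supportFunction_le (hK : IsCompact K) (hne : K.Nonempty)
    {p v : EuclideanSpace ℝ (Fin m)} (h : LineDifferentiableAt ℝ (supportFunction K) p v) :
    lineDeriv ℝ (supportFunction K) p v ≤ supportFunction K v := by
  have h1 := h.hasLineDerivAt.tendsto_slope_zero_right
  refine le_of_tendsto h1 ?_
  filter_upwards [self_mem_nhdsWithin] with t ht
  have ht' : 0 < t := ht
  have := supportFunction_add_le hK hne p (t • v)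
  rw [supportFunction_smul ht'.le] at this
  rw [smul_eq_mul, inv_mul_le_iff₀ ht']
  linarith

/-- Integrate ∂_v σ ≤ σ(v) against the weight (1-|x|²)₊. The weight vanishes on the unit sphere, so
integration by parts leaves no boundary term, and its gradient is -2x inside the ball. Hence the
left side becomes ∫ 2⟨x,v⟩σ(x) over the ball, which in polar coordinates is a multiple of ⟨v,
Steiner point⟩. -/
theorem inner_steinerPoint_le (hm : 0 < m) (hK : IsCompact K) (hne : K.Nonempty)
    (v : EuclideanSpace ℝ (Fin m)) : inner ℝ v (steinerPoint K) ≤ supportFunction K v := by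
  have : Nontrivial (EuclideanSpace ℝ (Fin m)) :=
    Module.nontrivial_of_finrank_pos (R := ℝ) (by simpa using hm)
  set μ := (volume : Measure (EuclideanSpace ℝ (Fin m))) with hμ
  set J := ∫ p : sphere (0 : EuclideanSpace ℝ (Fin m)) 1,
    supportFunction K (p : EuclideanSpace ℝ (Fin m)) * inner ℝ v (p : EuclideanSpace ℝ (Fin m))
    ∂μ.toSphere with hJ
  have hmR : (0 : ℝ) < m := Nat.cast_pos.2 hm
  have hstein : inner ℝ v (steinerPoint K) = m * ((μ.toSphere.real univ)⁻¹ * J) := by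
    rw [steinerPoint, real_inner_smul_right, average_eq, real_inner_smul_right, hJ,
      ← integral_inner (integrable_supportFunction_smul hK hne)]
    simp only [real_inner_smul_right, hμ]
  have hS : 0 < μ.toSphere.real univ := by
    refine ENNReal.toReal_pos ?_ (measure_ne_top _ _)
    rw [Ne, Measure.measure_univ_eq_zero]
    exact Measure.toSphere_ne_zero μ
  obtain ⟨C, hC⟩ := lipschitzWith_supportFunction hK hne
  have hparts := hC.integral_lineDeriv_mul_eq (μ := μ) (lipschitzWith_quadBump (m := m))
    hasCompactSupport_quadBump v
  -- The radial factor is ∫₀¹ r^(m-1)(1-r²) dr = 1/m - 1/(m+2).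
  have hI0 : ∫ x, quadBump x ∂μ = μ.toSphere.real univ * (2 / (m * (m + 2))) := by
    rw [integral_eq_mul_of_polar μ (A := fun _ => 1)
      (B := (Iio (1 : ℝ)).indicator fun r => 1 - r ^ 2), setIntegral_Ioi_mul_indicator]
    · rw [integral_const, smul_eq_mul, mul_one]
      congr 1
      obtain ⟨d, rfl⟩ : ∃ d, m = d + 1 := ⟨m - 1, by omega⟩
      have : ∀ r : ℝ, r ^ (Module.finrank ℝ (EuclideanSpace ℝ (Fin (d + 1))) - 1) * (1 - r ^ 2)
          = r ^ d - r ^ (d + 2) := by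
        intro r; rw [finrank_euclideanSpace_fin, Nat.add_sub_cancel]; ring
      simp_rw [this]
      rw [intervalIntegral.integral_sub (by simp) (by simp), integral_pow, integral_pow]
      push_cast
      field_simp
      ring
    · intro p r hr
      have hp : ‖(p : EuclideanSpace ℝ (Fin m))‖ = 1 := norm_eq_of_mem_sphere p
      rw [quadBump, norm_smul, hp, Real.norm_of_nonneg hr.le, mul_one, one_mul]
      by_cases h1 : r < 1
      · rw [indicator_of_mem (mem_Iio.2 h1), max_eq_right (by nlinarith)]
      · rw [indicator_of_notMem (by simpa using h1), max_eq_left (by nlinarith)]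
  -- Both σ and ⟨·,v⟩ are positively homogeneous of degree one, so the radial factor is ∫₀¹ 2r^(m+1)
  -- dr. The derivative formula fails at most on the unit sphere, a null set.
  have hI1 : ∫ x, lineDeriv ℝ quadBump x (-v) * supportFunction K x ∂μ = J * (2 / (m + 2)) := by
    have : ∫ x, lineDeriv ℝ quadBump x (-v) * supportFunction K x ∂μ =
        ∫ x, (if ‖x‖ < 1 then 2 * inner ℝ x v else 0) * supportFunction K x ∂μ := by
      refine integral_congr_ae ?_
      have hnull : ∀ᵐ x ∂μ, x ∉ sphere (0 : EuclideanSpace ℝ (Fin m)) 1 :=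
        measure_eq_zero_iff_ae_notMem.1 (Measure.addHaar_sphere μ 0 1)
      filter_upwards [hnull] with x hx
      rw [lineDeriv_quadBump (by simpa using hx)]
      simp
    rw [this, integral_eq_mul_of_polar μ (A := fun p =>
      supportFunction K (p : EuclideanSpace ℝ (Fin m)) * inner ℝ v (p : EuclideanSpace ℝ (Fin m)))
      (B := (Iio (1 : ℝ)).indicator fun r => 2 * r ^ 2), setIntegral_Ioi_mul_indicator]
    · congr 1
      obtain ⟨d, rfl⟩ : ∃ d, m = d + 1 := ⟨m - 1, by omega⟩
      have : ∀ r : ℝ, r ^ (Module.finrank ℝ (EuclideanSpace ℝ (Fin (d + 1))) - 1) * (2 * r ^ 2)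
          = 2 * r ^ (d + 2) := by
        intro r; rw [finrank_euclideanSpace_fin, Nat.add_sub_cancel]; ring
      simp_rw [this]
      rw [intervalIntegral.integral_const_mul, integral_pow]
      push_cast
      field_simp
      ring
    · intro p r hr
      have hp : ‖(p : EuclideanSpace ℝ (Fin m))‖ = 1 := norm_eq_of_mem_sphere p
      rw [norm_smul, hp, Real.norm_of_nonneg hr.le, mul_one, supportFunction_smul hr.le,
        real_inner_smul_left, real_inner_comm]
      by_cases h1 : r < 1
      · rw [indicator_of_mem (mem_Iio.2 h1), if_pos h1]; ring
      · rw [indicator_of_notMem (by simpa using h1), if_neg h1]; ring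
  have hle : ∫ x, lineDeriv ℝ (supportFunction K) x v * quadBump x ∂μ ≤
      ∫ x, supportFunction K v * quadBump x ∂μ := by
    have hgi : Integrable (fun x => quadBump x) μ :=
      lipschitzWith_quadBump.continuous.integrable_of_hasCompactSupport hasCompactSupport_quadBump
    refine integral_mono_ae ?_ (hgi.const_mul _) ?_
    · refine hgi.bdd_mul (c := C * ‖v‖) (measurable_lineDeriv hC.continuous).aestronglyMeasurable ?_
      exact Eventually.of_forall fun x => norm_lineDeriv_le_of_lipschitz ℝ hC
    · filter_upwards [hC.ae_lineDifferentiableAt (μ := μ) v] with x hx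
      exact mul_le_mul_of_nonneg_right (lineDeriv_supportFunction_le hK hne hx) (le_max_left _ _)
  rw [hparts, hI1, integral_const_mul, hI0] at hle
  rw [hstein]
  have h3 : J * m ≤ supportFunction K v * μ.toSphere.real univ := by
    have e1 : J * (2 / (m + 2)) = (J * m) * (2 / (m * (m + 2))) := by field_simp
    rw [e1, ← mul_assoc] at hle
    exact le_of_mul_le_mul_right hle (by positivity)
  rw [← mul_assoc, mul_comm (m : ℝ), mul_assoc, inv_mul_le_iff₀ hS]
  linarith

/-- A point outside `K` would be strictly separated from it, against the support function inequality
`inner_steinerPoint_le`. -/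
theorem steinerPoint_mem (hm : 0 < m) (hK : IsCompact K) (hne : K.Nonempty) (hc : Convex ℝ K) :
    steinerPoint K ∈ K := by
  by_contra hnot
  obtain ⟨f, u, hfu, hu⟩ := geometric_hahn_banach_closed_point hc hK.isClosed hnot
  set v := (InnerProductSpace.toDual ℝ (EuclideanSpace ℝ (Fin m))).symm f with hv
  have hfv : ∀ x, f x = inner ℝ v x := fun x => by
    rw [hv, InnerProductSpace.toDual_symm_apply]
  have h1 : supportFunction K v ≤ u := supportFunction_le hne fun x hx => by
    rw [← hfv]; exact (hfu x hx).le
  have h2 := inner_steinerPoint_le hm hK hne v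
  rw [← hfv] at h2
  linarith

end SupportFunction

/-! ### The parametrization as a function of one convex function and one point -/

section Slice

variable {n : ℕ} {h h₁ h₂ : EuclideanSpace ℝ (Fin n) → ℝ}

/-- The Steiner point of `P(w, epi h^*)`. -/
noncomputable def sliceParam (h : EuclideanSpace ℝ (Fin n) → ℝ)
    (w : EuclideanSpace ℝ (Fin (n + 1))) : EuclideanSpace ℝ (Fin (n + 1)) :=
  steinerPoint (nearSet w (conjEpi h))

theorem nonempty_conjEpi (hc : ConvexOn ℝ univ h) {C : ℝ} (hC : 0 ≤ C)
    (hl : ∀ p q, |h p - h q| ≤ C * ‖p - q‖) : (conjEpi h).Nonempty :=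
  let ⟨_, _, hv⟩ := hc.exists_subgradient hC hl 0
  ⟨_, mkPair_mem_conjEpi hv⟩

theorem sliceParam_mem_conjEpi (hne : (conjEpi h).Nonempty)
    (w : EuclideanSpace ℝ (Fin (n + 1))) : sliceParam h w ∈ conjEpi h :=
  (steinerPoint_mem n.succ_pos (isCompact_nearSet w (isClosed_conjEpi h))
    (nonempty_nearSet w (isClosed_conjEpi h) hne) (convex_nearSet w (convex_conjEpi h))).1

/-- Three estimates compose: 2κ between the epigraphs, the factor 10 for the near sets, and the
dimension n + 1 for Steiner points. -/
theorem dist_sliceParam_le (hc₁ : ConvexOn ℝ univ h₁) (hc₂ : ConvexOn ℝ univ h₂)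
    (hne₁ : (conjEpi h₁).Nonempty) (hne₂ : (conjEpi h₂).Nonempty) {κ : ℝ} (hκ : 0 ≤ κ)
    (hle : ∀ p, |h₁ p - h₂ p| ≤ κ * (1 + ‖p‖)) (w₁ w₂ : EuclideanSpace ℝ (Fin (n + 1))) :
    dist (sliceParam h₁ w₁) (sliceParam h₂ w₂) ≤ (n + 1) * (10 * (2 * κ + dist w₁ w₂)) := by
  have hle' : ∀ p, |h₂ p - h₁ p| ≤ κ * (1 + ‖p‖) := fun p => abs_sub_comm (h₁ p) _ ▸ hle p
  have h12 := fun z (hz : z ∈ conjEpi h₁) => exists_mem_conjEpi_dist_le hc₂ hκ hle hz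
  have h21 := fun z (hz : z ∈ conjEpi h₂) => exists_mem_conjEpi_dist_le hc₁ hκ hle' hz
  have hcl₁ := isClosed_conjEpi h₁
  have hcl₂ := isClosed_conjEpi h₂
  have := dist_steinerPoint_le (isCompact_nearSet w₁ hcl₁) (nonempty_nearSet w₁ hcl₁ hne₁)
    (isCompact_nearSet w₂ hcl₂) (nonempty_nearSet w₂ hcl₂ hne₂)
    (ρ := 10 * (2 * κ + dist w₁ w₂)) (by positivity)
    (fun z hz => exists_mem_nearSet_dist_le hne₂ hcl₂ (convex_conjEpi h₂) (by positivity)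
      h12 h21 w₁ w₂ hz)
    (fun z hz => by
      rw [dist_comm w₁ w₂]
      exact exists_mem_nearSet_dist_le hne₁ hcl₁ (convex_conjEpi h₁) (by positivity)
        h21 h12 w₂ w₁ hz)
  simpa [sliceParam] using this

/-- Uniform continuity of `(h, w) ↦ sliceParam h w`, along convex functions with conjugates bounded
by `M` on their domains, with respect to uniform convergence on balls. -/
theorem exists_forall_dist_sliceParam_le (n : ℕ) (M : ℝ) {ε : ℝ} (hε : 0 < ε) :
    ∃ P > 0, ∃ δ > 0, ∀ (h₁ h₂ : EuclideanSpace ℝ (Fin n) → ℝ) (C : ℝ)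
      (w₁ w₂ : EuclideanSpace ℝ (Fin (n + 1))), ConvexOn ℝ univ h₁ → ConvexOn ℝ univ h₂ → 0 ≤ C →
      (∀ p q, |h₁ p - h₁ q| ≤ C * ‖p - q‖) → (∀ p q, |h₂ p - h₂ q| ≤ C * ‖p - q‖) →
      (∀ v p, (∀ q, h₁ p + inner ℝ v (q - p) ≤ h₁ q) → |inner ℝ v p - h₁ p| ≤ M) →
      (∀ v p, (∀ q, h₂ p + inner ℝ v (q - p) ≤ h₂ q) → |inner ℝ v p - h₂ p| ≤ M) →
      (∀ p, ‖p‖ ≤ P → |h₁ p - h₂ p| ≤ δ) → dist w₁ w₂ ≤ δ →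
      dist (sliceParam h₁ w₁) (sliceParam h₂ w₂) ≤ ε := by
  -- With κ = δ and dist w₁ w₂ ≤ δ the bound is (n+1)·10·(2δ+δ) = ε. The radius P below makes δ +
  -- 4|M| = δP. The Lipschitz constant `C` affects neither choice.
  set δ := ε / (30 * (n + 1)) with hδ
  have hδ0 : 0 < δ := by positivity
  refine ⟨(δ + 4 * |M|) / δ, by positivity, δ, hδ0, ?_⟩
  intro h₁ h₂ C w₁ w₂ hc₁ hc₂ hC hl₁ hl₂ hM₁ hM₂ hle hw
  have hκ := abs_sub_le_of_conj_bounded hc₁ hc₂ hC hl₁ hl₂ hM₁ hM₂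
    (P := (δ + 4 * |M|) / δ) (by positivity) hle le_rfl
    (by rw [mul_div_cancel₀ _ hδ0.ne']; linarith [le_abs_self M])
  refine (dist_sliceParam_le hc₁ hc₂ (nonempty_conjEpi hc₁ hC hl₁) (nonempty_conjEpi hc₂ hC hl₂)
    hδ0.le hκ w₁ w₂).trans ?_
  calc (n + 1 : ℝ) * (10 * (2 * δ + dist w₁ w₂)) ≤ (n + 1) * (10 * (2 * δ + δ)) := by gcongr
    _ = ε := by rw [hδ]; field_simp; norm_num

end Slice

/-! ### Regularity and convergence of the constructed representation -/

section Representation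

variable {n : ℕ} {T : ℝ} {H : ℝ → EuclideanSpace ℝ (Fin n) → EuclideanSpace ℝ (Fin n) → ℝ}
  {lam : ℝ → EuclideanSpace ℝ (Fin n) → ℝ} {c : ℝ → ℝ} {k : ℝ → ℝ → ℝ}

theorem epiParam_eq_sliceParam (t : ℝ) (x : EuclideanSpace ℝ (Fin n))
    (a : EuclideanSpace ℝ (Fin (n + 1))) :
    epiParam H lam c t x a = sliceParam (H t x) (scaling H lam c t x • a) := by
  rw [epiParam, sliceParam, epiLagrangian_eq_conjEpi]

namespace HamiltonianConditions

theorem lipschitz_slice (hH : HamiltonianConditions T H c k) {t : ℝ} (ht : t ∈ Icc 0 T)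
    (x : EuclideanSpace ℝ (Fin n)) :
    0 ≤ c t * (1 + ‖x‖) ∧ ∀ p q, |H t x p - H t x q| ≤ c t * (1 + ‖x‖) * ‖p - q‖ :=
  ⟨mul_nonneg (hH.growth_nonneg t ht) (by positivity), hH.growth t ht x⟩

theorem nonempty_conjEpi (hH : HamiltonianConditions T H c k) {t : ℝ} (ht : t ∈ Icc 0 T)
    (x : EuclideanSpace ℝ (Fin n)) : (conjEpi (H t x)).Nonempty :=
  _root_.nonempty_conjEpi (hH.convex t ht x) (hH.lipschitz_slice ht x).1 (hH.lipschitz_slice ht x).2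

/-- The Steiner point lies in the epigraph, so its first component lies in the effective domain of
L(t,x,·), which the Lipschitz bound in p confines. -/
theorem norm_repDynamics_le (hH : HamiltonianConditions T H c k) {t : ℝ} (ht : t ∈ Icc 0 T)
    (x : EuclideanSpace ℝ (Fin n)) (a : EuclideanSpace ℝ (Fin (n + 1))) :
    ‖repDynamics H lam c t x a‖ ≤ c t * (1 + ‖x‖) := by
  rw [repDynamics, epiParam_eq_sliceParam]
  exact norm_proj₁_le_of_mem_conjEpi (hH.lipschitz_slice ht x).1 (hH.lipschitz_slice ht x).2
    (sliceParam_mem_conjEpi (hH.nonempty_conjEpi ht x) _)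

/-- For a subgradient v at p the supremum defining L(t,x,v) is attained at p, hence finite and at
most λ(t,x). Testing with q = 0 bounds it below by -H(t,x,0). -/
theorem abs_conj_le (hL : BoundedLagrangian T H lam k) {t : ℝ} (ht : t ∈ Icc 0 T)
    (x : EuclideanSpace ℝ (Fin n)) {v p : EuclideanSpace ℝ (Fin n)}
    (hv : ∀ q, H t x p + inner ℝ v (q - p) ≤ H t x q) :
    |inner ℝ v p - H t x p| ≤ |lam t x| + |H t x 0| := by
  have hlag : lagrangian H t x v = ((inner ℝ v p - H t x p : ℝ) : EReal) := by
    refine le_antisymm (iSup_le fun q => EReal.coe_le_coe_iff.2 ?_)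
      (le_iSup (fun q => ((inner ℝ v q - H t x q : ℝ) : EReal)) p)
    have := hv q
    rw [inner_sub_right] at this
    linarith
  have h1 := hL.bound t ht x v (by rw [hlag]; exact EReal.coe_ne_top _)
    (by rw [hlag]; exact EReal.coe_ne_bot _)
  rw [hlag, EReal.coe_le_coe_iff] at h1
  have h2 := hv 0
  rw [inner_sub_right, inner_zero_right] at h2
  rw [abs_le]
  constructor
  · linarith [le_abs_self (H t x 0), abs_nonneg (lam t x)]
  · linarith [le_abs_self (lam t x), abs_nonneg (H t x 0)]

/-- Of the coefficient 4k + c, a part 2k comes from moving the epigraph and 2k + c from moving the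
centre ω(t,x)a: k each for λ and H(·,·,0), and c for c(1+|x|). -/
theorem dist_epiParam_le (hH : HamiltonianConditions T H c k) (hL : BoundedLagrangian T H lam k)
    {R : ℝ} (hR : 0 < R) {t : ℝ} (ht : t ∈ Icc 0 T) {x y : EuclideanSpace ℝ (Fin n)}
    (hx : x ∈ closedBall 0 R) (hy : y ∈ closedBall 0 R) {a : EuclideanSpace ℝ (Fin (n + 1))}
    (ha : a ∈ closedBall 0 1) :
    dist (epiParam H lam c t x a) (epiParam H lam c t y a) ≤
      (n + 1) * (10 * (4 * k R t + c t)) * ‖x - y‖ := by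
  have hk := hH.rate_nonneg R hR t ht
  have hc := hH.growth_nonneg t ht
  rw [epiParam_eq_sliceParam, epiParam_eq_sliceParam]
  have h1 := dist_sliceParam_le (hH.convex t ht x) (hH.convex t ht y) (hH.nonempty_conjEpi ht x)
    (hH.nonempty_conjEpi ht y) (κ := k R t * ‖x - y‖) (by positivity)
    (fun p => by
      have := hH.lipschitz R hR t ht x hx y hy p
      linarith) (scaling H lam c t x • a) (scaling H lam c t y • a)
  have h2 : dist (scaling H lam c t x • a) (scaling H lam c t y • a) ≤
      (2 * k R t + c t) * ‖x - y‖ := by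
    rw [dist_eq_norm, ← sub_smul, norm_smul, Real.norm_eq_abs]
    have ha' : ‖a‖ ≤ 1 := mem_closedBall_zero_iff.1 ha
    refine (mul_le_of_le_one_right (abs_nonneg _) ha').trans ?_
    have e1 := (abs_abs_sub_abs_le (lam t x) (lam t y)).trans (hL.lipschitz R hR t ht x hx y hy)
    have e2 := (abs_abs_sub_abs_le (H t x 0) (H t y 0)).trans (hH.lipschitz R hR t ht x hx y hy 0)
    have e3 : |c t * (‖x‖ - ‖y‖)| ≤ c t * ‖x - y‖ := by
      rw [abs_mul, abs_of_nonneg hc]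
      exact mul_le_mul_of_nonneg_left (abs_norm_sub_norm_le x y) hc
    rw [norm_zero, add_zero, mul_one] at e2
    have e4 : scaling H lam c t x - scaling H lam c t y =
        (|lam t x| - |lam t y|) + (|H t x 0| - |H t y 0|) + c t * (‖x‖ - ‖y‖) := by
      unfold scaling; ring
    rw [e4]
    refine (abs_add_three _ _ _).trans ?_
    linarith
  refine h1.trans ?_
  rw [mul_assoc]
  refine mul_le_mul_of_nonneg_left ?_ (by positivity)
  linarith

end HamiltonianConditions

/-- Joint continuity of `H`, `λ` and `c` on `[0,T] × ⋯`. -/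
structure JointlyContinuous (T : ℝ)
    (H : ℝ → EuclideanSpace ℝ (Fin n) → EuclideanSpace ℝ (Fin n) → ℝ)
    (lam : ℝ → EuclideanSpace ℝ (Fin n) → ℝ) (c : ℝ → ℝ) : Prop where
  hamiltonian : ContinuousOn
    (fun z : ℝ × EuclideanSpace ℝ (Fin n) × EuclideanSpace ℝ (Fin n) => H z.1 z.2.1 z.2.2)
    (Icc 0 T ×ˢ univ)
  bound : ContinuousOn (fun z : ℝ × EuclideanSpace ℝ (Fin n) => lam z.1 z.2) (Icc 0 T ×ˢ univ)
  growth : ContinuousOn c (Icc 0 T)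

namespace JointlyContinuous

theorem hamiltonian_zero (h : JointlyContinuous T H lam c) :
    ContinuousOn (fun z : ℝ × EuclideanSpace ℝ (Fin n) => H z.1 z.2 0) (Icc 0 T ×ˢ univ) :=
  h.hamiltonian.comp (f := fun z : ℝ × EuclideanSpace ℝ (Fin n) => (z.1, z.2, 0))
    (by fun_prop) fun _ hz => ⟨hz.1, trivial⟩

theorem exists_bound (h : JointlyContinuous T H lam c) (R : ℝ) :
    ∃ M, ∀ t ∈ Icc 0 T, ∀ x ∈ closedBall 0 R, |lam t x| + |H t x 0| ≤ M := by
  have hK : IsCompact (Icc 0 T ×ˢ closedBall (0 : EuclideanSpace ℝ (Fin n)) R) :=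
    isCompact_Icc.prod (isCompact_closedBall _ _)
  have hsub : Icc 0 T ×ˢ closedBall (0 : EuclideanSpace ℝ (Fin n)) R ⊆ Icc 0 T ×ˢ univ :=
    prod_mono_right (subset_univ _)
  obtain ⟨M, hM⟩ := hK.bddAbove_image
    ((h.bound.abs.add h.hamiltonian_zero.abs).mono hsub)
  exact ⟨M, fun t ht x hx => hM (mem_image_of_mem _ (mk_mem_prod ht hx))⟩

theorem scaling (h : JointlyContinuous T H lam c) :
    ContinuousOn (fun z : ℝ × EuclideanSpace ℝ (Fin n) => scaling H lam c z.1 z.2)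
      (Icc 0 T ×ˢ univ) := by
  unfold _root_.scaling
  have hc : ContinuousOn (fun z : ℝ × EuclideanSpace ℝ (Fin n) => c z.1) (Icc 0 T ×ˢ univ) :=
    h.growth.comp continuousOn_fst fun _ hz => hz.1
  exact ((h.bound.abs.add h.hamiltonian_zero.abs).add
    (hc.mul (by fun_prop))).add continuousOn_const

/-- Near a given point, |λ| + |H(·,·,0)| has a common bound M. The modulus of
`exists_forall_dist_sliceParam_le` for this M then needs only uniform continuity of H on a compact
set and continuity of ω. -/
theorem continuousOn_epiParam (hJ : JointlyContinuous T H lam c)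
    (hH : HamiltonianConditions T H c k) (hL : BoundedLagrangian T H lam k) :
    ContinuousOn (fun z : ℝ × EuclideanSpace ℝ (Fin n) × EuclideanSpace ℝ (Fin (n + 1)) =>
      epiParam H lam c z.1 z.2.1 z.2.2) (Icc 0 T ×ˢ univ) := by
  rintro ⟨t₀, x₀, a₀⟩ ⟨ht₀, -⟩
  rw [Metric.continuousWithinAt_iff']
  intro ε hε
  set R := ‖x₀‖ + 1 with hR
  obtain ⟨M, hM⟩ := hJ.exists_bound R
  obtain ⟨P, hP, δ, hδ, key⟩ := exists_forall_dist_sliceParam_le n M (half_pos hε)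
  have hw : ∀ᶠ z : ℝ × EuclideanSpace ℝ (Fin n) × EuclideanSpace ℝ (Fin (n + 1)) in
      𝓝[Icc 0 T ×ˢ univ] (t₀, x₀, a₀),
      dist (_root_.scaling H lam c z.1 z.2.1 • z.2.2) (_root_.scaling H lam c t₀ x₀ • a₀) ≤ δ := by
    have h1 : ContinuousOn
        (fun z : ℝ × EuclideanSpace ℝ (Fin n) × EuclideanSpace ℝ (Fin (n + 1)) =>
          _root_.scaling H lam c z.1 z.2.1 • z.2.2) (Icc 0 T ×ˢ univ) := by
      have h0 : ContinuousOn
          (fun z : ℝ × EuclideanSpace ℝ (Fin n) × EuclideanSpace ℝ (Fin (n + 1)) =>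
            _root_.scaling H lam c z.1 z.2.1) (Icc 0 T ×ˢ univ) :=
        hJ.scaling.comp
          (f := fun z : ℝ × EuclideanSpace ℝ (Fin n) × EuclideanSpace ℝ (Fin (n + 1)) =>
            (z.1, z.2.1)) (by fun_prop) fun z hz => ⟨hz.1, trivial⟩
      fun_prop
    have h2 := Metric.continuousWithinAt_iff'.1 (h1 (t₀, x₀, a₀) ⟨ht₀, trivial⟩) δ hδ
    exact h2.mono fun z hz => hz.le
  have hK : IsCompact (Icc 0 T ×ˢ (closedBall (0 : EuclideanSpace ℝ (Fin n)) R ×ˢ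
      closedBall (0 : EuclideanSpace ℝ (Fin n)) P)) :=
    isCompact_Icc.prod ((isCompact_closedBall _ _).prod (isCompact_closedBall _ _))
  have hu := hK.uniformContinuousOn_of_continuous
    (hJ.hamiltonian.mono (prod_mono_right (subset_univ _)))
  rw [Metric.uniformContinuousOn_iff] at hu
  obtain ⟨η, hη, hu⟩ := hu δ hδ
  have hnear : ∀ᶠ z : ℝ × EuclideanSpace ℝ (Fin n) × EuclideanSpace ℝ (Fin (n + 1)) in
      𝓝[Icc 0 T ×ˢ univ] (t₀, x₀, a₀), dist z (t₀, x₀, a₀) < min η 1 :=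
    nhdsWithin_le_nhds (ball_mem_nhds _ (by positivity))
  filter_upwards [hw, hnear, self_mem_nhdsWithin] with z hzw hzn hzS
  have ht : z.1 ∈ Icc 0 T := hzS.1
  have hdt : dist z.1 t₀ < min η 1 := (le_max_left _ _).trans_lt hzn
  have hdx : dist z.2.1 x₀ < min η 1 :=
    ((le_max_left _ _).trans (le_max_right _ _)).trans_lt hzn
  have hxR : z.2.1 ∈ closedBall (0 : EuclideanSpace ℝ (Fin n)) R := by
    rw [mem_closedBall_zero_iff]
    have := norm_sub_norm_le z.2.1 x₀
    rw [← dist_eq_norm] at this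
    linarith [hdx.trans_le (min_le_right η 1)]
  have hx₀R : x₀ ∈ closedBall (0 : EuclideanSpace ℝ (Fin n)) R := by
    rw [mem_closedBall_zero_iff]; linarith
  obtain ⟨hC₁, hl₁⟩ := hH.lipschitz_slice ht z.2.1
  obtain ⟨hC₂, hl₂⟩ := hH.lipschitz_slice ht₀ x₀
  rw [epiParam_eq_sliceParam, epiParam_eq_sliceParam]
  refine (key (H z.1 z.2.1) (H t₀ x₀) (max (c z.1 * (1 + ‖z.2.1‖)) (c t₀ * (1 + ‖x₀‖))) _ _
    (hH.convex _ ht _) (hH.convex _ ht₀ _) (hC₁.trans (le_max_left _ _))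
    (fun p q => (hl₁ p q).trans (by gcongr; exact le_max_left _ _))
    (fun p q => (hl₂ p q).trans (by gcongr; exact le_max_right _ _))
    (fun v p hv => (HamiltonianConditions.abs_conj_le hL ht _ hv).trans (hM _ ht _ hxR))
    (fun v p hv => (HamiltonianConditions.abs_conj_le hL ht₀ _ hv).trans (hM _ ht₀ _ hx₀R))
    (fun p hp => ?_) hzw).trans_lt (half_lt_self hε)
  have hpP : p ∈ closedBall (0 : EuclideanSpace ℝ (Fin n)) P := by simpa using hp
  refine (hu (z.1, z.2.1, p) ⟨ht, hxR, hpP⟩ (t₀, x₀, p) ⟨ht₀, hx₀R, hpP⟩ ?_).le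
  rw [Prod.dist_eq, Prod.dist_eq, dist_self]
  exact max_lt (hdt.trans_le (min_le_left _ _))
    (max_lt (hdx.trans_le (min_le_left _ _)) hη)

end JointlyContinuous

theorem TendstoUniformlyOnCompactsIn.continuousOn {X : Type*} [PseudoMetricSpace X] [ProperSpace X]
    {F : ℕ → X → ℝ} {F₀ : X → ℝ} {S : Set X} (h : TendstoUniformlyOnCompactsIn F F₀ S)
    (hS : IsClosed S) (hF : ∀ i, ContinuousOn (F i) S) : ContinuousOn F₀ S := by
  intro z hz
  have hK : IsCompact (S ∩ closedBall z 1) := (isCompact_closedBall z 1).inter_left hS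
  have hc := (h _ inter_subset_left hK).continuousOn
    (Eventually.of_forall fun i => (hF i).mono inter_subset_left).frequently
  refine (hc z ⟨hz, mem_closedBall_self zero_le_one⟩).mono_of_mem_nhdsWithin ?_
  exact inter_mem self_mem_nhdsWithin (nhdsWithin_le_nhds (closedBall_mem_nhds z one_pos))

/-- Uniform convergence of the parametrizations on bounded sets. -/
theorem eventually_dist_epiParam_le
    {Hs : ℕ → ℝ → EuclideanSpace ℝ (Fin n) → EuclideanSpace ℝ (Fin n) → ℝ}
    {lams : ℕ → ℝ → EuclideanSpace ℝ (Fin n) → ℝ} {ks : ℕ → ℝ → ℝ → ℝ} {cs : ℕ → ℝ → ℝ}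
    (hHs : ∀ i, HamiltonianConditions T (Hs i) (cs i) (ks i))
    (hH : HamiltonianConditions T H c k)
    (hLs : ∀ i, BoundedLagrangian T (Hs i) (lams i) (ks i))
    (hL : BoundedLagrangian T H lam k) (hJ : JointlyContinuous T H lam c)
    (hH_lim : TendstoUniformlyOnCompactsIn
      (fun i (z : ℝ × EuclideanSpace ℝ (Fin n) × EuclideanSpace ℝ (Fin n)) =>
        Hs i z.1 z.2.1 z.2.2)
      (fun z => H z.1 z.2.1 z.2.2) (Icc 0 T ×ˢ univ))
    (hlam_lim : TendstoUniformlyOnCompactsIn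
      (fun i (z : ℝ × EuclideanSpace ℝ (Fin n)) => lams i z.1 z.2)
      (fun z => lam z.1 z.2) (Icc 0 T ×ˢ univ))
    (hc_lim : TendstoUniformlyOnCompactsIn cs c (Icc 0 T)) (R : ℝ) (hR : 0 ≤ R)
    {ε : ℝ} (hε : 0 < ε) :
    ∀ᶠ i in atTop, ∀ t ∈ Icc 0 T, ∀ x ∈ closedBall 0 R, ∀ a ∈ closedBall 0 1,
      dist (epiParam (Hs i) (lams i) (cs i) t x a) (epiParam H lam c t x a) ≤ ε := by
  obtain ⟨M, hM⟩ := hJ.exists_bound R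
  -- The conjugates of the approximating Hamiltonians are bounded by M + 2, since λ and H(·,·,0)
  -- each change by at most η ≤ 1. In the choice of η, the factor 3 + R adds up the change of ω: η
  -- for each of λ and H, and η(1+R) for the growth term.
  obtain ⟨P, hP, δ, hδ, key⟩ := exists_forall_dist_sliceParam_le n (M + 2) hε
  set η := min (δ / (3 + R)) 1 with hη
  have hη0 : 0 < η := by positivity
  have hη1 : η ≤ 1 := min_le_right _ _
  have hηδ : η * (3 + R) ≤ δ := (le_div_iff₀ (by positivity)).1 (min_le_left _ _)
  have h1 := Metric.tendstoUniformlyOn_iff.1 (hH_lim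
    (Icc 0 T ×ˢ (closedBall (0 : EuclideanSpace ℝ (Fin n)) R ×ˢ
      closedBall (0 : EuclideanSpace ℝ (Fin n)) P)) (prod_mono_right (subset_univ _))
    (isCompact_Icc.prod ((isCompact_closedBall _ _).prod (isCompact_closedBall _ _)))) η hη0
  have h2 := Metric.tendstoUniformlyOn_iff.1 (hlam_lim
    (Icc 0 T ×ˢ closedBall (0 : EuclideanSpace ℝ (Fin n)) R) (prod_mono_right (subset_univ _))
    (isCompact_Icc.prod (isCompact_closedBall _ _))) η hη0
  have h3 := Metric.tendstoUniformlyOn_iff.1 (hc_lim (Icc 0 T) subset_rfl isCompact_Icc) η hη0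
  filter_upwards [h1, h2, h3] with i h1 h2 h3 t ht x hx a ha
  have hHd : ∀ p, ‖p‖ ≤ P → |Hs i t x p - H t x p| ≤ η := fun p hp => by
    have := h1 (t, x, p) ⟨ht, hx, by simpa using hp⟩
    rw [dist_comm, Real.dist_eq] at this
    exact this.le
  have hld : |lams i t x - lam t x| ≤ η := by
    have := h2 (t, x) ⟨ht, hx⟩
    rw [dist_comm, Real.dist_eq] at this
    exact this.le
  have hcd : |cs i t - c t| ≤ η := by
    have := h3 t ht
    rw [dist_comm, Real.dist_eq] at this
    exact this.le
  have hH0 := hHd 0 (by simpa using hP.le)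
  have hMx := hM t ht x hx
  have hxR : ‖x‖ ≤ R := mem_closedBall_zero_iff.1 hx
  obtain ⟨hC₁, hl₁⟩ := (hHs i).lipschitz_slice ht x
  obtain ⟨hC₂, hl₂⟩ := hH.lipschitz_slice ht x
  have e1 := (abs_abs_sub_abs_le (lams i t x) (lam t x)).trans hld
  have e2 := (abs_abs_sub_abs_le (Hs i t x 0) (H t x 0)).trans hH0
  rw [epiParam_eq_sliceParam, epiParam_eq_sliceParam]
  refine key (Hs i t x) (H t x) (max (cs i t * (1 + ‖x‖)) (c t * (1 + ‖x‖))) _ _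
    ((hHs i).convex _ ht _) (hH.convex _ ht _) (hC₁.trans (le_max_left _ _))
    (fun p q => (hl₁ p q).trans (by gcongr; exact le_max_left _ _))
    (fun p q => (hl₂ p q).trans (by gcongr; exact le_max_right _ _))
    (fun v p hv => (HamiltonianConditions.abs_conj_le (hLs i) ht _ hv).trans ?_)
    (fun v p hv => (HamiltonianConditions.abs_conj_le hL ht _ hv).trans (by linarith))
    (fun p hp => (hHd p hp).trans ?_) ?_
  · linarith [(abs_le.1 e1).2, (abs_le.1 e2).2]
  · nlinarith
  · rw [dist_eq_norm, ← sub_smul, norm_smul, Real.norm_eq_abs]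
    have ha' : ‖a‖ ≤ 1 := mem_closedBall_zero_iff.1 ha
    refine (mul_le_of_le_one_right (abs_nonneg _) ha').trans ?_
    have e3 : |(cs i t - c t) * (1 + ‖x‖)| ≤ η * (1 + R) := by
      rw [abs_mul, abs_of_nonneg (show 0 ≤ 1 + ‖x‖ by positivity)]
      gcongr
    have e4 : scaling (Hs i) (lams i) (cs i) t x - scaling H lam c t x =
        (|lams i t x| - |lam t x|) + (|Hs i t x 0| - |H t x 0|) + (cs i t - c t) * (1 + ‖x‖) := by
      unfold scaling; ring
    rw [e4]
    refine (abs_add_three _ _ _).trans ?_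
    linarith

end Representation

/-! ### Integral equations, Grönwall's inequality, absolutely continuous solutions -/

section IntegralEquation

theorem intervalIntegrable_of_bound {V : Type*} [NormedAddCommGroup V]
    {t₀ T s t B : ℝ} {φ : ℝ → V}
    (hm : AEStronglyMeasurable φ (volume.restrict (Icc t₀ T)))
    (hB : ∀ᵐ s ∂volume.restrict (Icc t₀ T), ‖φ s‖ ≤ B) (hs : s ∈ Icc t₀ T) (ht : t ∈ Icc t₀ T) :
    IntervalIntegrable φ volume s t := by
  have h1 : IntegrableOn φ (Icc t₀ T) := Integrable.of_bound hm B hB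
  exact (h1.mono_set (uIcc_subset_Icc hs ht)).intervalIntegrable

/-- Existence for the integral equation `x = x₀ + ∫ G(s, x(s)) ds`, with `G` bounded, measurable
along continuous curves and globally Lipschitz in the state. -/
theorem exists_integral_solution {V : Type*} [NormedAddCommGroup V] [NormedSpace ℝ V]
    [CompleteSpace V] {t₀ T : ℝ} (hT : t₀ ≤ T) (G : ℝ → V → V)
    (hm : ∀ x : ℝ → V, Continuous x →
      AEStronglyMeasurable (fun s => G s (x s)) (volume.restrict (Icc t₀ T)))
    {B : ℝ} (hB : ∀ s x, ‖G s x‖ ≤ B) {L : ℝ} (hL0 : 0 ≤ L)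
    (hL : ∀ s x y, ‖G s x - G s y‖ ≤ L * ‖x - y‖) (x₀ : V) :
    ∃ x : ℝ → V, Continuous x ∧ ∀ t ∈ Icc t₀ T, x t = x₀ + ∫ s in t₀..t, G s (x s) := by
  have ht₀ : t₀ ∈ Icc t₀ T := left_mem_Icc.2 hT
  let ext : C(Icc t₀ T, V) → ℝ → V := fun α => IccExtend hT α
  have hext : ∀ α, Continuous (ext α) := fun α => α.continuous.Icc_extend'
  have hint : ∀ (α : C(Icc t₀ T, V)) (t : ℝ), t ∈ Icc t₀ T →
      IntervalIntegrable (fun s => G s (ext α s)) volume t₀ t := fun α t ht =>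
    intervalIntegrable_of_bound (hm _ (hext α)) (Eventually.of_forall fun s => hB s _) ht₀ ht
  let Ψ : C(Icc t₀ T, V) → C(Icc t₀ T, V) := fun α =>
    { toFun := fun t => x₀ + ∫ s in t₀..(t : ℝ), G s (ext α s)
      continuous_toFun := by
        have h1 := intervalIntegral.continuousOn_primitive_interval'
          (hint α T (right_mem_Icc.2 hT)) (left_mem_uIcc)
        rw [uIcc_of_le hT] at h1
        exact continuous_const.add (continuousOn_iff_continuous_domRestrict.1 h1) }
  have hΨ : ∀ α t, Ψ α t = x₀ + ∫ s in t₀..(t : ℝ), G s (ext α s) := fun α t => rfl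
  -- The factorial bound makes some iterate of the Picard map a contraction on the whole interval;
  -- the fixed point of that iterate is fixed by the map itself.
  have hiter : ∀ (k : ℕ) (α β : C(Icc t₀ T, V)) (t : Icc t₀ T),
      ‖Ψ^[k] α t - Ψ^[k] β t‖ ≤ L ^ k * ((t - t₀) ^ k / k.factorial) * dist α β := by
    intro k α β
    induction k with
    | zero =>
      intro t
      simpa [← dist_eq_norm] using ContinuousMap.dist_apply_le_dist t
    | succ k ih =>
      intro t
      rw [Function.iterate_succ_apply', Function.iterate_succ_apply', hΨ, hΨ,
        add_sub_add_left_eq_sub, ← intervalIntegral.integral_sub (hint _ t t.2) (hint _ t t.2)]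
      have hbd : ‖∫ s in t₀..(t : ℝ), (G s (ext (Ψ^[k] α) s) - G s (ext (Ψ^[k] β) s))‖ ≤
          ∫ s in t₀..(t : ℝ), L * (L ^ k * ((s - t₀) ^ k / k.factorial) * dist α β) := by
        refine intervalIntegral.norm_integral_le_of_norm_le t.2.1 ?_
          (Continuous.intervalIntegrable (by fun_prop) _ _)
        refine Eventually.of_forall fun s hs => (hL _ _ _).trans ?_
        have hs' : s ∈ Icc t₀ T := ⟨hs.1.le, hs.2.trans t.2.2⟩
        have h1 := ih ⟨s, hs'⟩
        simp only [ext, IccExtend_of_mem hT _ hs']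
        exact mul_le_mul_of_nonneg_left h1 hL0
      refine hbd.trans (le_of_eq ?_)
      have hpow : ∫ s in t₀..(t : ℝ), (s - t₀) ^ k = (t - t₀) ^ (k + 1) / (k + 1) := by
        rw [intervalIntegral.integral_comp_sub_right (fun s => s ^ k) t₀, integral_pow]
        simp
      have hrw : ∀ s : ℝ, L * (L ^ k * ((s - t₀) ^ k / k.factorial) * dist α β) =
          (L ^ (k + 1) / k.factorial * dist α β) * (s - t₀) ^ k := fun s => by ring
      simp_rw [hrw]
      rw [intervalIntegral.integral_const_mul, hpow, Nat.factorial_succ]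
      push_cast
      field_simp
  obtain ⟨k, hk⟩ := FloorSemiring.tendsto_pow_div_factorial_atTop (L * (T - t₀))
    |>.eventually (gt_mem_nhds zero_lt_one) |>.exists
  have hk0 : 0 ≤ (L * (T - t₀)) ^ k / k.factorial := by
    have : 0 ≤ T - t₀ := by linarith
    positivity
  have hcontr : ContractingWith ⟨_, hk0⟩ Ψ^[k] := by
    refine ⟨hk, LipschitzWith.of_dist_le_mul fun α β => ?_⟩
    refine (ContinuousMap.dist_le (mul_nonneg hk0 dist_nonneg)).2 fun t => ?_
    rw [dist_eq_norm]
    refine (hiter k α β t).trans ?_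
    have h0 : 0 ≤ (t : ℝ) - t₀ := by linarith [t.2.1]
    have h1 : ((t : ℝ) - t₀) ^ k ≤ (T - t₀) ^ k :=
      pow_le_pow_left₀ h0 (by linarith [t.2.2]) k
    change _ ≤ (L * (T - t₀)) ^ k / k.factorial * dist α β
    rw [mul_pow, mul_div_assoc]
    gcongr
  have hfix : Ψ (ContractingWith.fixedPoint _ hcontr) = ContractingWith.fixedPoint _ hcontr :=
    hcontr.isFixedPt_fixedPoint_iterate
  set α := ContractingWith.fixedPoint _ hcontr
  refine ⟨ext α, hext α, fun t ht => ?_⟩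
  calc ext α t = α ⟨t, ht⟩ := IccExtend_of_mem hT _ ht
    _ = Ψ α ⟨t, ht⟩ := by rw [hfix]
    _ = _ := hΨ α _

/-- Grönwall's inequality in integral form. -/
theorem le_gronwallBound_of_le_integral {u : ℝ → ℝ} {δ K ε t₀ T : ℝ}
    (hu : ContinuousOn u (Icc t₀ T)) (hK : 0 ≤ K)
    (h : ∀ t ∈ Icc t₀ T, u t ≤ δ + ∫ s in t₀..t, (K * u s + ε)) :
    ∀ t ∈ Icc t₀ T, u t ≤ gronwallBound δ K ε (t - t₀) := by
  intro t ht
  have hT : t₀ ≤ T := ht.1.trans ht.2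
  set v : ℝ → ℝ := IccExtend hT (domRestrict (Icc t₀ T) u) with hv
  have hvc : Continuous v := (continuousOn_iff_continuous_domRestrict.1 hu).Icc_extend'
  have hvu : ∀ s ∈ Icc t₀ T, v s = u s := fun s hs => by
    rw [hv, IccExtend_of_mem hT _ hs]; rfl
  -- The right-hand side is a differentiable majorant with w' = Kv + ε ≤ Kw + ε on the interval, so
  -- the differential form of Grönwall applies to it. Extending u to the continuous v makes w
  -- differentiable everywhere.
  set w : ℝ → ℝ := fun t => δ + ∫ s in t₀..t, (K * v s + ε) with hw
  have hwd : ∀ t, HasDerivAt w (K * v t + ε) t := fun t =>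
    ((by fun_prop : Continuous fun s => K * v s + ε).integral_hasStrictDerivAt t₀ t).hasDerivAt
      |>.const_add δ
  have huw : ∀ s ∈ Icc t₀ T, u s ≤ w s := fun s hs => by
    refine (h s hs).trans (le_of_eq ?_)
    rw [hw]
    congr 1
    refine intervalIntegral.integral_congr fun r hr => ?_
    rw [uIcc_of_le hs.1] at hr
    simp only [hvu r ⟨hr.1, hr.2.trans hs.2⟩]
  refine (huw t ht).trans ?_
  refine le_gronwallBound_of_liminf_deriv_right_le (f := w) (f' := fun t => K * v t + ε) (b := T)
    (fun s _ => (hwd s).continuousAt.continuousWithinAt)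
    (fun s _ r hr => (hwd s).hasDerivWithinAt.liminf_right_slope_le hr) ?_ (fun s hs => ?_) t ht
  · simp [hw]
  · have hs' := Ico_subset_Icc_self hs
    have := huw s hs'
    rw [← hvu s hs'] at this
    gcongr

theorem absolutelyContinuousOnInterval_integral {V : Type*} [NormedAddCommGroup V]
    [NormedSpace ℝ V] {φ : ℝ → V} {t₀ T B : ℝ} (hT : t₀ ≤ T)
    (hm : AEStronglyMeasurable φ (volume.restrict (Icc t₀ T)))
    (hB : ∀ᵐ s ∂volume.restrict (Icc t₀ T), ‖φ s‖ ≤ B) :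
    AbsolutelyContinuousOnInterval (fun t => ∫ s in t₀..t, φ s) t₀ T := by
  have ht₀ : t₀ ∈ Icc t₀ T := left_mem_Icc.2 hT
  refine LipschitzOnWith.absolutelyContinuousOnInterval (K := B.toNNReal) ?_
  rw [uIcc_of_le hT]
  refine LipschitzOnWith.of_dist_le_mul fun s hs t ht => ?_
  rw [dist_eq_norm, intervalIntegral.integral_interval_sub_left
    (intervalIntegrable_of_bound hm hB ht₀ hs) (intervalIntegrable_of_bound hm hB ht₀ ht),
    Real.dist_eq]
  refine (intervalIntegral.norm_integral_le_of_norm_le_const_ae (C := B) ?_).trans ?_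
  · filter_upwards [(ae_restrict_iff' measurableSet_Icc).1 hB] with r hr hrm
    exact hr (uIcc_subset_Icc ht hs (uIoc_subset_uIcc hrm))
  · exact mul_le_mul_of_nonneg_right (Real.le_coe_toNNReal B) (abs_nonneg _)

/-- Absolutely continuous solutions of `x' = φ` a.e., with `φ` bounded and measurable, are
primitives of `φ`. -/
theorem AbsolutelyContinuousOnInterval.eq_add_integral {V : Type*} [NormedAddCommGroup V]
    [NormedSpace ℝ V] [CompleteSpace V] {x φ : ℝ → V} {t₀ T B : ℝ} (hT : t₀ ≤ T)
    (hx : AbsolutelyContinuousOnInterval x t₀ T)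
    (hd : ∀ᵐ t ∂volume.restrict (Icc t₀ T), HasDerivAt x (φ t) t)
    (hm : AEStronglyMeasurable φ (volume.restrict (Icc t₀ T)))
    (hB : ∀ᵐ s ∂volume.restrict (Icc t₀ T), ‖φ s‖ ≤ B) :
    ∀ t ∈ Icc t₀ T, x t = x t₀ + ∫ s in t₀..t, φ s := by
  have ht₀ : t₀ ∈ Icc t₀ T := left_mem_Icc.2 hT
  have hy := absolutelyContinuousOnInterval_integral hT hm hB
  have hφ := intervalIntegrable_of_bound hm hB ht₀ (right_mem_Icc.2 hT)
  -- The difference of x and the primitive is absolutely continuous with zero derivative a.e., hence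
  -- constant.
  obtain ⟨c, hc⟩ := (hx.sub hy).const_of_ae_hasDerivAt_zero (by
    rw [uIcc_of_le hT]
    filter_upwards [(ae_restrict_iff' measurableSet_Icc).1 hd, hφ.ae_hasDerivAt_integral]
      with t h1 h2 ht
    rw [uIcc_of_le hT] at h2
    have := (h1 ht).sub (h2 ht t₀ ht₀)
    rwa [sub_self] at this)
  rw [uIcc_of_le hT] at hc
  intro t ht
  have h1 := hc t ht
  have h2 := hc t₀ ht₀
  simp only [Pi.sub_apply, intervalIntegral.integral_same, sub_zero] at h1 h2
  rw [h2, ← h1]; abel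

end IntegralEquation

/-! ### Radial truncation of states and controls -/

section RadialRetraction

variable {V : Type*} [NormedAddCommGroup V] [NormedSpace ℝ V] {R : ℝ}

/-- The radial retraction onto the closed ball of radius `R`. -/
noncomputable def radialRetraction (R : ℝ) (x : V) : V := (R / max R ‖x‖) • x

theorem radialRetraction_mem (hR : 0 < R) (x : V) : radialRetraction R x ∈ closedBall (0 : V) R := by
  have h : 0 < max R ‖x‖ := hR.trans_le (le_max_left _ _)
  rw [mem_closedBall_zero_iff, radialRetraction, norm_smul, Real.norm_of_nonneg (by positivity),
    div_mul_eq_mul_div]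
  exact div_le_of_le_mul₀ h.le hR.le (mul_le_mul_of_nonneg_left (le_max_right _ _) hR.le)

theorem radialRetraction_of_mem (hR : 0 < R) {x : V} (hx : x ∈ closedBall (0 : V) R) :
    radialRetraction R x = x := by
  rw [mem_closedBall_zero_iff] at hx
  rw [radialRetraction, max_eq_left hx, div_self hR.ne', one_smul]

/-- Writing a = max(R,|x|) and b = max(R,|y|), the difference is (R/a)(x-y) + (R/a-R/b)y, and each
term has norm at most |x-y|. This works in any norm, at the price of the constant 2. -/
theorem norm_radialRetraction_sub_le (hR : 0 < R) (x y : V) :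
    ‖radialRetraction R x - radialRetraction R y‖ ≤ 2 * ‖x - y‖ := by
  set a := max R ‖x‖ with ha
  set b := max R ‖y‖ with hb
  have ha0 : 0 < a := hR.trans_le (le_max_left _ _)
  have hb0 : 0 < b := hR.trans_le (le_max_left _ _)
  have hRa : R / a ≤ 1 := div_le_one_of_le₀ (le_max_left _ _) ha0.le
  have hyb : ‖y‖ / b ≤ 1 := div_le_one_of_le₀ (le_max_right _ _) hb0.le
  have hab : |b - a| ≤ ‖x - y‖ := by
    have h1 := abs_max_sub_max_le_max R ‖y‖ R ‖x‖
    rw [sub_self, abs_zero, max_eq_right (abs_nonneg (‖y‖ - ‖x‖))] at h1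
    rw [← norm_neg (x - y), neg_sub]
    exact h1.trans (abs_norm_sub_norm_le y x)
  have h1 : radialRetraction R x - radialRetraction R y =
      (R / a) • (x - y) + (R / a - R / b) • y := by
    rw [radialRetraction, radialRetraction, ← ha, ← hb]; module
  have h2 : |R / a - R / b| * ‖y‖ ≤ ‖x - y‖ := by
    have : |R / a - R / b| * ‖y‖ = (R / a) * (‖y‖ / b) * |b - a| := by
      have e : R / a - R / b = R / (a * b) * (b - a) := by field_simp
      rw [e, abs_mul, abs_of_nonneg (by positivity)]
      field_simp
    rw [this]
    have hyb0 : 0 ≤ ‖y‖ / b := by positivity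
    calc (R / a) * (‖y‖ / b) * |b - a| ≤ 1 * 1 * ‖x - y‖ := by gcongr
      _ = ‖x - y‖ := by ring
  rw [h1]
  refine (norm_add_le _ _).trans ?_
  rw [norm_smul, norm_smul, Real.norm_of_nonneg (by positivity : 0 ≤ R / a), Real.norm_eq_abs]
  nlinarith [norm_nonneg (x - y)]

theorem norm_radialRetraction_le (hR : 0 < R) (x : V) : ‖radialRetraction R x‖ ≤ ‖x‖ := by
  have h : 0 < max R ‖x‖ := hR.trans_le (le_max_left _ _)
  rw [radialRetraction, norm_smul, Real.norm_of_nonneg (by positivity)]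
  exact mul_le_of_le_one_left (norm_nonneg x) (div_le_one_of_le₀ (le_max_left _ _) h.le)

theorem continuous_radialRetraction (hR : 0 < R) : Continuous (radialRetraction R : V → V) := by
  unfold radialRetraction
  refine Continuous.smul (continuous_const.div (by fun_prop) fun x => ?_) continuous_id
  exact (hR.trans_le (le_max_left _ _)).ne'

end RadialRetraction

/-! ### Control systems: a priori bounds, existence of trajectories, finiteness -/

section ControlSystem

variable {n m : ℕ} {T t₀ : ℝ}

/-- The law of s ↦ (s, x(s), a(s)) is carried by the set on which F is continuous, so continuity on
that set suffices. -/
theorem aestronglyMeasurable_comp_pair {W : Type*} [TopologicalSpace W]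
    [TopologicalSpace.PseudoMetrizableSpace W]
    {F : ℝ → EuclideanSpace ℝ (Fin n) → EuclideanSpace ℝ (Fin m) → W}
    (hF : ContinuousOn
      (fun z : ℝ × EuclideanSpace ℝ (Fin n) × EuclideanSpace ℝ (Fin m) => F z.1 z.2.1 z.2.2)
      (Icc 0 T ×ˢ (univ ×ˢ closedBall 0 1)))
    (ht₀ : 0 ≤ t₀) {x : ℝ → EuclideanSpace ℝ (Fin n)} (hx : ContinuousOn x (Icc t₀ T))
    {a : ℝ → EuclideanSpace ℝ (Fin m)} (ha : AEMeasurable a (volume.restrict (Icc t₀ T)))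
    (hmem : ∀ᵐ t ∂volume.restrict (Icc t₀ T), a t ∈ closedBall 0 1) :
    AEStronglyMeasurable (fun s => F s (x s) (a s)) (volume.restrict (Icc t₀ T)) := by
  have hz : AEMeasurable (fun s => (s, x s, a s)) (volume.restrict (Icc t₀ T)) :=
    aemeasurable_id.prodMk ((hx.aemeasurable measurableSet_Icc).prodMk ha)
  have hS : MeasurableSet (Icc 0 T ×ˢ ((univ : Set (EuclideanSpace ℝ (Fin n))) ×ˢ
      closedBall (0 : EuclideanSpace ℝ (Fin m)) 1)) :=
    measurableSet_Icc.prod (MeasurableSet.univ.prod measurableSet_closedBall)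
  have hmap : ∀ᵐ z ∂(volume.restrict (Icc t₀ T)).map (fun s => (s, x s, a s)),
      z ∈ Icc 0 T ×ˢ ((univ : Set (EuclideanSpace ℝ (Fin n))) ×ˢ
        closedBall (0 : EuclideanSpace ℝ (Fin m)) 1) := by
    refine (ae_map_iff hz hS).2 ?_
    filter_upwards [hmem, ae_restrict_mem measurableSet_Icc] with s h1 h2
    exact ⟨⟨ht₀.trans h2.1, h2.2⟩, trivial, h1⟩
  have h1 := hF.aestronglyMeasurable
    (μ := (volume.restrict (Icc t₀ T)).map (fun s => (s, x s, a s))) hS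
  rw [Measure.restrict_eq_self_of_ae_mem hmap] at h1
  exact h1.comp_aemeasurable hz

theorem one_add_norm_le_of_integral_eq {V : Type*} [NormedAddCommGroup V] [NormedSpace ℝ V]
    {x φ : ℝ → V} {x₀ : V} {C : ℝ} (hC : 0 ≤ C) (hx : ContinuousOn x (Icc t₀ T))
    (h : ∀ t ∈ Icc t₀ T, x t = x₀ + ∫ s in t₀..t, φ s)
    (hφ : ∀ᵐ s ∂volume.restrict (Icc t₀ T), ‖φ s‖ ≤ C * (1 + ‖x s‖)) :
    ∀ t ∈ Icc t₀ T, 1 + ‖x t‖ ≤ (1 + ‖x₀‖) * Real.exp (C * (t - t₀)) := by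
  intro t ht
  rw [← gronwallBound_ε0]
  have hu : ContinuousOn (fun s => 1 + ‖x s‖) (Icc t₀ T) := continuousOn_const.add hx.norm
  refine le_gronwallBound_of_le_integral (u := fun s => 1 + ‖x s‖) hu hC (fun t ht => ?_) t ht
  simp only [add_zero]
  have h1 : ‖∫ s in t₀..t, φ s‖ ≤ ∫ s in t₀..t, C * (1 + ‖x s‖) := by
    refine intervalIntegral.norm_integral_le_of_norm_le ht.1 ?_ ?_
    · filter_upwards [(ae_restrict_iff' measurableSet_Icc).1 hφ] with s hs hsm
      exact hs ⟨hsm.1.le, hsm.2.trans ht.2⟩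
    · refine ContinuousOn.intervalIntegrable ?_
      rw [uIcc_of_le ht.1]
      exact (continuousOn_const.mul hu).mono (Icc_subset_Icc_right ht.2)
  have h2 := norm_add_le x₀ (∫ s in t₀..t, φ s)
  rw [← h t ht] at h2
  linarith

/-- A control system on `[0,T]` with controls in the closed unit ball whose dynamics `f` and
running cost `l` are continuous and locally Lipschitz in the state, and whose dynamics have linear
growth with constant `C`. -/
structure IsRegularSystem (T C : ℝ)
    (f : ℝ → EuclideanSpace ℝ (Fin n) → EuclideanSpace ℝ (Fin m) → EuclideanSpace ℝ (Fin n))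
    (l : ℝ → EuclideanSpace ℝ (Fin n) → EuclideanSpace ℝ (Fin m) → ℝ) : Prop where
  growth_nonneg : 0 ≤ C
  growth : ∀ t ∈ Icc 0 T, ∀ x a, ‖f t x a‖ ≤ C * (1 + ‖x‖)
  continuous_dynamics : ContinuousOn
    (fun z : ℝ × EuclideanSpace ℝ (Fin n) × EuclideanSpace ℝ (Fin m) => f z.1 z.2.1 z.2.2)
    (Icc 0 T ×ˢ (univ ×ˢ closedBall 0 1))
  continuous_cost : ContinuousOn
    (fun z : ℝ × EuclideanSpace ℝ (Fin n) × EuclideanSpace ℝ (Fin m) => l z.1 z.2.1 z.2.2)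
    (Icc 0 T ×ˢ (univ ×ˢ closedBall 0 1))
  lipschitz : ∀ R > 0, ∃ K > 0, ∀ t ∈ Icc 0 T, ∀ x ∈ closedBall 0 R, ∀ y ∈ closedBall 0 R,
    ∀ a ∈ closedBall 0 1,
      ‖f t x a - f t y a‖ ≤ K * ‖x - y‖ ∧ |l t x a - l t y a| ≤ K * ‖x - y‖

namespace IsRegularSystem

variable {C : ℝ}
  {f : ℝ → EuclideanSpace ℝ (Fin n) → EuclideanSpace ℝ (Fin m) → EuclideanSpace ℝ (Fin n)}
  {l : ℝ → EuclideanSpace ℝ (Fin n) → EuclideanSpace ℝ (Fin m) → ℝ}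
  {x : ℝ → EuclideanSpace ℝ (Fin n)} {a : ℝ → EuclideanSpace ℝ (Fin m)}
  {x₀ : EuclideanSpace ℝ (Fin n)}

theorem continuousOn_trajectory (ht₀ : t₀ ∈ Icc 0 T)
    (hp : IsTrajectoryControlPair f (closedBall 0 1) T t₀ x₀ x a) :
    ContinuousOn x (Icc t₀ T) := by
  have := hp.absolutelyContinuous.continuousOn
  rwa [uIcc_of_le ht₀.2] at this

theorem aestronglyMeasurable_dynamics (hS : IsRegularSystem T C f l) (ht₀ : t₀ ∈ Icc 0 T)
    (hp : IsTrajectoryControlPair f (closedBall 0 1) T t₀ x₀ x a) :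
    AEStronglyMeasurable (fun s => f s (x s) (a s)) (volume.restrict (Icc t₀ T)) :=
  aestronglyMeasurable_comp_pair hS.continuous_dynamics ht₀.1 (continuousOn_trajectory ht₀ hp)
    hp.control_measurable hp.control_mem

theorem exists_bound_dynamics (hS : IsRegularSystem T C f l) (ht₀ : t₀ ∈ Icc 0 T)
    (hp : IsTrajectoryControlPair f (closedBall 0 1) T t₀ x₀ x a) :
    ∃ B, ∀ᵐ s ∂volume.restrict (Icc t₀ T), ‖f s (x s) (a s)‖ ≤ B := by
  obtain ⟨M, hM⟩ := isCompact_Icc.bddAbove_image (continuousOn_trajectory ht₀ hp).norm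
  refine ⟨C * (1 + M), ?_⟩
  filter_upwards [ae_restrict_mem measurableSet_Icc] with s hs
  refine (hS.growth s ⟨ht₀.1.trans hs.1, hs.2⟩ (x s) (a s)).trans ?_
  have := hM (mem_image_of_mem _ hs)
  exact mul_le_mul_of_nonneg_left (by simpa using this) hS.growth_nonneg

theorem trajectory_eq (hS : IsRegularSystem T C f l) (ht₀ : t₀ ∈ Icc 0 T)
    (hp : IsTrajectoryControlPair f (closedBall 0 1) T t₀ x₀ x a) :
    ∀ t ∈ Icc t₀ T, x t = x₀ + ∫ s in t₀..t, f s (x s) (a s) := by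
  obtain ⟨B, hB⟩ := hS.exists_bound_dynamics ht₀ hp
  have := hp.absolutelyContinuous.eq_add_integral ht₀.2 hp.equation
    (hS.aestronglyMeasurable_dynamics ht₀ hp) hB
  rwa [hp.initial] at this

/-- Grönwall for 1 + |x|. The radius depends only on r, C and T, so it serves every control, every
initial time and all systems sharing C. -/
theorem trajectory_mem_closedBall (hS : IsRegularSystem T C f l) (ht₀ : t₀ ∈ Icc 0 T)
    (hp : IsTrajectoryControlPair f (closedBall 0 1) T t₀ x₀ x a) {r : ℝ} (hr : ‖x₀‖ ≤ r) :
    ∀ t ∈ Icc t₀ T, x t ∈ closedBall 0 ((1 + r) * Real.exp (C * T)) := by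
  intro t ht
  have hC := hS.growth_nonneg
  have h1 := one_add_norm_le_of_integral_eq hC (continuousOn_trajectory ht₀ hp)
    (hS.trajectory_eq ht₀ hp) (by
      filter_upwards [ae_restrict_mem measurableSet_Icc] with s hs
      exact hS.growth s ⟨ht₀.1.trans hs.1, hs.2⟩ _ _) t ht
  have h2 : t - t₀ ≤ T := by linarith [ht.2, ht₀.1]
  rw [mem_closedBall_zero_iff]
  calc ‖x t‖ ≤ (1 + ‖x₀‖) * Real.exp (C * (t - t₀)) := by linarith
    _ ≤ (1 + r) * Real.exp (C * T) := by
      gcongr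
      linarith [norm_nonneg x₀]

/-- Every measurable control has a trajectory. -/
theorem exists_trajectory (hS : IsRegularSystem T C f l) (ht₀ : t₀ ∈ Icc 0 T)
    (x₀ : EuclideanSpace ℝ (Fin n)) (ha : AEMeasurable a (volume.restrict (Icc t₀ T)))
    (hmem : ∀ᵐ t ∂volume.restrict (Icc t₀ T), a t ∈ closedBall 0 1) :
    ∃ x, IsTrajectoryControlPair f (closedBall 0 1) T t₀ x₀ x a := by
  have hC := hS.growth_nonneg
  have hT : 0 ≤ T := ht₀.1.trans ht₀.2
  set R := (1 + ‖x₀‖) * Real.exp (C * T) with hR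
  have hR0 : 0 < R := by positivity
  obtain ⟨K, hK, hlip⟩ := hS.lipschitz R hR0
  let p : ℝ → ℝ := fun s => projIcc 0 T hT s
  have hp : ∀ s, p s ∈ Icc 0 T := fun s => (projIcc 0 T hT s).2
  have hpid : ∀ s ∈ Icc 0 T, p s = s := fun s hs => by
    simp only [p, projIcc_of_mem hT hs]
  -- Time, state and control are truncated so that the field becomes globally bounded and Lipschitz.
  -- The state truncation does not increase norms, so the growth bound survives; the solution stays
  -- in the ball of radius R, where the truncation does nothing.
  let F : ℝ → EuclideanSpace ℝ (Fin n) → EuclideanSpace ℝ (Fin m) → EuclideanSpace ℝ (Fin n) :=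
    fun s y b => f (p s) (radialRetraction R y) (radialRetraction 1 b)
  let G : ℝ → EuclideanSpace ℝ (Fin n) → EuclideanSpace ℝ (Fin n) := fun s y => F s y (a s)
  have hFc : Continuous (fun z : ℝ × EuclideanSpace ℝ (Fin n) × EuclideanSpace ℝ (Fin m) =>
      F z.1 z.2.1 z.2.2) := by
    have h1 : Continuous (fun z : ℝ × EuclideanSpace ℝ (Fin n) × EuclideanSpace ℝ (Fin m) =>
        (p z.1, radialRetraction R z.2.1, radialRetraction 1 z.2.2)) :=
      ((continuous_subtype_val.comp continuous_projIcc).comp continuous_fst).prodMk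
        (((continuous_radialRetraction hR0).comp (continuous_fst.comp continuous_snd)).prodMk
          ((continuous_radialRetraction one_pos).comp (continuous_snd.comp continuous_snd)))
    exact hS.continuous_dynamics.comp_continuous h1 fun z =>
      ⟨hp _, trivial, radialRetraction_mem one_pos _⟩
  have hGm : ∀ x : ℝ → EuclideanSpace ℝ (Fin n), Continuous x →
      AEStronglyMeasurable (fun s => G s (x s)) (volume.restrict (Icc t₀ T)) := fun x hx =>
    aestronglyMeasurable_comp_pair (F := F) hFc.continuousOn ht₀.1 hx.continuousOn ha hmem
  have hGg : ∀ s y, ‖G s y‖ ≤ C * (1 + ‖radialRetraction R y‖) := fun s y =>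
    hS.growth _ (hp s) _ _
  have hGB : ∀ s y, ‖G s y‖ ≤ C * (1 + R) := fun s y => (hGg s y).trans (by
    have := mem_closedBall_zero_iff.1 (radialRetraction_mem hR0 y)
    gcongr)
  have hGL : ∀ s y z, ‖G s y - G s z‖ ≤ (K * 2) * ‖y - z‖ := fun s y z => by
    refine (hlip _ (hp s) _ (radialRetraction_mem hR0 y) _ (radialRetraction_mem hR0 z) _
      (radialRetraction_mem one_pos (a s))).1.trans ?_
    rw [mul_assoc]
    exact mul_le_mul_of_nonneg_left (norm_radialRetraction_sub_le hR0 y z) hK.le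
  obtain ⟨x, hxc, hx⟩ := exists_integral_solution ht₀.2 G hGm hGB (by positivity) hGL x₀
  have hxR : ∀ t ∈ Icc t₀ T, x t ∈ closedBall (0 : EuclideanSpace ℝ (Fin n)) R := by
    intro t ht
    have h1 := one_add_norm_le_of_integral_eq hC hxc.continuousOn hx
      (Eventually.of_forall fun s => (hGg s (x s)).trans (by
        have := norm_radialRetraction_le hR0 (x s)
        gcongr)) t ht
    have h2 : t - t₀ ≤ T := by linarith [ht.2, ht₀.1]
    rw [mem_closedBall_zero_iff]
    calc ‖x t‖ ≤ (1 + ‖x₀‖) * Real.exp (C * (t - t₀)) := by linarith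
      _ ≤ R := by rw [hR]; gcongr
  have hmeas := hGm x hxc
  have hbound : ∀ᵐ s ∂volume.restrict (Icc t₀ T), ‖G s (x s)‖ ≤ C * (1 + R) :=
    Eventually.of_forall fun s => hGB s (x s)
  -- The primitive is taken as trajectory instead of `x`, with which it agrees on [t₀,T] only: its
  -- a.e. derivative is given directly by Lebesgue differentiation.
  refine ⟨fun t => x₀ + ∫ s in t₀..t, G s (x s), ha, hmem, ?_, by simp, ?_⟩
  · exact ((LipschitzWith.const x₀).lipschitzOnWith).absolutelyContinuousOnInterval.add
      (absolutelyContinuousOnInterval_integral ht₀.2 hmeas hbound)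
  · have hd := (intervalIntegrable_of_bound hmeas hbound (left_mem_Icc.2 ht₀.2)
      (right_mem_Icc.2 ht₀.2)).ae_hasDerivAt_integral
    rw [uIcc_of_le ht₀.2] at hd
    filter_upwards [ae_restrict_of_ae hd, hmem, ae_restrict_mem measurableSet_Icc] with s h1 h2 h3
    have h4 := (h1 h3 t₀ (left_mem_Icc.2 ht₀.2)).const_add x₀
    have e : f s (x₀ + ∫ r in t₀..s, G r (x r)) (a s) = G s (x s) := by
      rw [← hx s h3]
      simp only [G, F]
      rw [hpid s ⟨ht₀.1.trans h3.1, h3.2⟩, radialRetraction_of_mem hR0 (hxR s h3),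
        radialRetraction_of_mem one_pos h2]
    change HasDerivAt _ (f s (x₀ + ∫ r in t₀..s, G r (x r)) (a s)) s
    rw [e]
    exact h4

theorem intervalIntegrable_cost (hS : IsRegularSystem T C f l) (ht₀ : t₀ ∈ Icc 0 T)
    (hp : IsTrajectoryControlPair f (closedBall 0 1) T t₀ x₀ x a) :
    IntervalIntegrable (fun t => l t (x t) (a t)) volume t₀ T ∧
    ∀ M, (∀ t ∈ Icc 0 T, ∀ y ∈ closedBall 0 ((1 + ‖x₀‖) * Real.exp (C * T)),
      ∀ b ∈ closedBall 0 1, |l t y b| ≤ M) →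
      |∫ t in t₀..T, l t (x t) (a t)| ≤ M * T := by
  have hmem := hS.trajectory_mem_closedBall ht₀ hp le_rfl
  have hbd : ∀ M, (∀ t ∈ Icc 0 T, ∀ y ∈ closedBall 0 ((1 + ‖x₀‖) * Real.exp (C * T)),
      ∀ b ∈ closedBall 0 1, |l t y b| ≤ M) →
      ∀ᵐ s ∂volume.restrict (Icc t₀ T), ‖l s (x s) (a s)‖ ≤ M := by
    intro M hM
    filter_upwards [hp.control_mem, ae_restrict_mem measurableSet_Icc] with s h1 h2
    exact hM s ⟨ht₀.1.trans h2.1, h2.2⟩ _ (hmem s h2) _ h1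
  constructor
  · obtain ⟨M, hM⟩ := (isCompact_Icc.prod ((isCompact_closedBall (0 : EuclideanSpace ℝ (Fin n))
      ((1 + ‖x₀‖) * Real.exp (C * T))).prod
        (isCompact_closedBall (0 : EuclideanSpace ℝ (Fin m)) 1))).bddAbove_image
      (hS.continuous_cost.abs.mono (prod_mono_right (prod_mono_left (subset_univ _))))
    refine intervalIntegrable_of_bound (B := M) (aestronglyMeasurable_comp_pair hS.continuous_cost
      ht₀.1 (continuousOn_trajectory ht₀ hp) hp.control_measurable hp.control_mem)
      (hbd M fun t ht y hy b hb => hM (mem_image_of_mem _ (mk_mem_prod ht (mk_mem_prod hy hb))))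
      (left_mem_Icc.2 ht₀.2) (right_mem_Icc.2 ht₀.2)
  · intro M hM
    have hM0 : 0 ≤ M := (abs_nonneg _).trans (hM t₀ ht₀ 0
      (mem_closedBall_self (by positivity)) 0 (mem_closedBall_self zero_le_one))
    have h1 := intervalIntegral.norm_integral_le_of_norm_le_const_ae (C := M) (a := t₀) (b := T)
      (f := fun t => l t (x t) (a t)) (by
        filter_upwards [(ae_restrict_iff' measurableSet_Icc).1 (hbd M hM)] with s hs hsm
        rw [uIoc_of_le ht₀.2] at hsm
        exact hs (Ioc_subset_Icc_self hsm))
    rw [abs_of_nonneg (by linarith [ht₀.2])] at h1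
    exact h1.trans (mul_le_mul_of_nonneg_left (by linarith [ht₀.1]) hM0)

theorem valueWellDefined (hS : IsRegularSystem T C f l) {g : EuclideanSpace ℝ (Fin n) → ℝ}
    (hg : Continuous g) : ValueWellDefined (closedBall 0 1) f l g T := by
  intro t₀ ht₀ x₀
  refine ⟨fun x a hp => (hS.intervalIntegrable_cost ht₀ hp).1, ?_, ?_⟩
  · obtain ⟨x, hx⟩ := hS.exists_trajectory (a := fun _ => 0) ht₀ x₀ aemeasurable_const
      (Eventually.of_forall fun _ => mem_closedBall_self zero_le_one)
    exact ⟨_, x, _, hx, rfl⟩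
  · have hK := isCompact_closedBall (0 : EuclideanSpace ℝ (Fin n))
      ((1 + ‖x₀‖) * Real.exp (C * T))
    obtain ⟨M, hM⟩ := (isCompact_Icc.prod (hK.prod
        (isCompact_closedBall (0 : EuclideanSpace ℝ (Fin m)) 1))).bddAbove_image
      (hS.continuous_cost.abs.mono (prod_mono_right (prod_mono_left (subset_univ _))))
    obtain ⟨N, hN⟩ := hK.bddBelow_image hg.continuousOn
    refine ⟨N - M * T, ?_⟩
    rintro r ⟨x, a, hp, rfl⟩
    have h1 := (abs_le.1 ((hS.intervalIntegrable_cost ht₀ hp).2 M fun t ht y hy b hb =>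
      hM (mem_image_of_mem _ (mk_mem_prod ht (mk_mem_prod hy hb))))).1
    have h2 := hN (mem_image_of_mem g
      (hS.trajectory_mem_closedBall ht₀ hp le_rfl T (right_mem_Icc.2 ht₀.2)))
    linarith

end IsRegularSystem

end ControlSystem

/-! ### Stability of value functions under perturbation of the system -/

section Stability

theorem abs_csInf_sub_csInf_le {S₁ S₂ : Set ℝ} {η : ℝ} (h₁ : S₁.Nonempty) (h₂ : S₂.Nonempty)
    (hb₁ : BddBelow S₁) (hb₂ : BddBelow S₂) (h12 : ∀ r ∈ S₁, ∃ r' ∈ S₂, |r - r'| ≤ η)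
    (h21 : ∀ r ∈ S₂, ∃ r' ∈ S₁, |r - r'| ≤ η) : |sInf S₁ - sInf S₂| ≤ η := by
  have key : ∀ {S₁ S₂ : Set ℝ}, S₁.Nonempty → BddBelow S₂ →
      (∀ r ∈ S₁, ∃ r' ∈ S₂, |r - r'| ≤ η) → sInf S₂ - η ≤ sInf S₁ := by
    intro S₁ S₂ h₁ hb₂ h
    refine le_csInf h₁ fun r hr => ?_
    obtain ⟨r', hr', hrr'⟩ := h r hr
    linarith [csInf_le hb₂ hr', (abs_le.1 hrr').1]
  rw [abs_le]
  constructor <;> linarith [key h₁ hb₂ h12, key h₂ hb₁ h21]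

variable {n m : ℕ} {T C : ℝ}

namespace IsRegularSystem

variable {f₁ f₂ f : ℝ → EuclideanSpace ℝ (Fin n) → EuclideanSpace ℝ (Fin m) →
    EuclideanSpace ℝ (Fin n)}
  {l₁ l₂ l : ℝ → EuclideanSpace ℝ (Fin n) → EuclideanSpace ℝ (Fin m) → ℝ}
  {t₀ R K ε : ℝ} {x₁ x₂ : ℝ → EuclideanSpace ℝ (Fin n)} {a : ℝ → EuclideanSpace ℝ (Fin m)}
  {x₀ : EuclideanSpace ℝ (Fin n)}

/-- Trajectories of nearby systems with the same control and initial state are close. -/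
theorem norm_trajectory_sub_le (hS₁ : IsRegularSystem T C f₁ l₁) (hS₂ : IsRegularSystem T C f₂ l₂)
    (ht₀ : t₀ ∈ Icc 0 T) (hp₁ : IsTrajectoryControlPair f₁ (closedBall 0 1) T t₀ x₀ x₁ a)
    (hp₂ : IsTrajectoryControlPair f₂ (closedBall 0 1) T t₀ x₀ x₂ a)
    (hx₁ : ∀ t ∈ Icc t₀ T, x₁ t ∈ closedBall 0 R) (hx₂ : ∀ t ∈ Icc t₀ T, x₂ t ∈ closedBall 0 R)
    (hK : 0 < K) (hlip : ∀ t ∈ Icc 0 T, ∀ x ∈ closedBall 0 R, ∀ y ∈ closedBall 0 R,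
      ∀ b ∈ closedBall 0 1, ‖f₂ t x b - f₂ t y b‖ ≤ K * ‖x - y‖) (hε0 : 0 ≤ ε)
    (hε : ∀ t ∈ Icc 0 T, ∀ x ∈ closedBall 0 R, ∀ b ∈ closedBall 0 1,
      ‖f₁ t x b - f₂ t x b‖ ≤ ε) :
    ∀ t ∈ Icc t₀ T, ‖x₁ t - x₂ t‖ ≤ ε * (Real.exp (K * T) / K) := by
  intro t ht
  have hc : ContinuousOn (fun s => ‖x₁ s - x₂ s‖) (Icc t₀ T) :=
    ((continuousOn_trajectory ht₀ hp₁).sub (continuousOn_trajectory ht₀ hp₂)).norm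
  obtain ⟨B₁, hB₁⟩ := hS₁.exists_bound_dynamics ht₀ hp₁
  obtain ⟨B₂, hB₂⟩ := hS₂.exists_bound_dynamics ht₀ hp₂
  have hle := le_gronwallBound_of_le_integral (u := fun s => ‖x₁ s - x₂ s‖) (δ := 0) (ε := ε) hc
    hK.le (fun t ht => by
      have hi₁ := intervalIntegrable_of_bound (hS₁.aestronglyMeasurable_dynamics ht₀ hp₁) hB₁
        (left_mem_Icc.2 ht₀.2) ht
      have hi₂ := intervalIntegrable_of_bound (hS₂.aestronglyMeasurable_dynamics ht₀ hp₂) hB₂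
        (left_mem_Icc.2 ht₀.2) ht
      rw [hS₁.trajectory_eq ht₀ hp₁ t ht, hS₂.trajectory_eq ht₀ hp₂ t ht,
        add_sub_add_left_eq_sub, ← intervalIntegral.integral_sub hi₁ hi₂, zero_add]
      refine intervalIntegral.norm_integral_le_of_norm_le ht.1 ?_ ?_
      · filter_upwards [(ae_restrict_iff' measurableSet_Icc).1 hp₁.control_mem] with s hs hsm
        have hs' : s ∈ Icc t₀ T := ⟨hsm.1.le, hsm.2.trans ht.2⟩
        have hs0 : s ∈ Icc 0 T := ⟨ht₀.1.trans hs'.1, hs'.2⟩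
        -- Inserting f₂ along the first trajectory uses the Lipschitz constant of f₂ alone; with f₂
        -- the limit dynamics, no uniform constant for the approximating systems is needed.
        have e1 := hε s hs0 _ (hx₁ s hs') _ (hs hs')
        have e2 := hlip s hs0 _ (hx₁ s hs') _ (hx₂ s hs') _ (hs hs')
        have e3 := norm_sub_le_norm_sub_add_norm_sub (f₁ s (x₁ s) (a s)) (f₂ s (x₁ s) (a s))
          (f₂ s (x₂ s) (a s))
        linarith
      · refine ContinuousOn.intervalIntegrable ?_
        rw [uIcc_of_le ht.1]
        exact ((continuousOn_const.mul hc).add continuousOn_const).mono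
          (Icc_subset_Icc_right ht.2)) t ht
  refine hle.trans ?_
  rw [gronwallBound_of_K_ne_0 hK.ne']
  have h1 : Real.exp (K * (t - t₀)) ≤ Real.exp (K * T) := by
    gcongr
    linarith [ht.2, ht₀.1]
  have h2 : 0 ≤ ε / K := by positivity
  calc 0 * Real.exp (K * (t - t₀)) + ε / K * (Real.exp (K * (t - t₀)) - 1)
      ≤ ε / K * Real.exp (K * T) := by
        rw [zero_mul, zero_add]
        exact mul_le_mul_of_nonneg_left (by linarith) h2
    _ = ε * (Real.exp (K * T) / K) := by ring

/-- Inserting l₂ along the first trajectory bounds the integrand by ε for the change of cost plus K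
D for the change of trajectory. -/
theorem abs_integral_cost_sub_le (hS₁ : IsRegularSystem T C f₁ l₁)
    (hS₂ : IsRegularSystem T C f₂ l₂)
    (ht₀ : t₀ ∈ Icc 0 T) (hp₁ : IsTrajectoryControlPair f₁ (closedBall 0 1) T t₀ x₀ x₁ a)
    (hp₂ : IsTrajectoryControlPair f₂ (closedBall 0 1) T t₀ x₀ x₂ a)
    (hx₁ : ∀ t ∈ Icc t₀ T, x₁ t ∈ closedBall 0 R) (hx₂ : ∀ t ∈ Icc t₀ T, x₂ t ∈ closedBall 0 R)
    (hK : 0 < K) (hlip : ∀ t ∈ Icc 0 T, ∀ x ∈ closedBall 0 R, ∀ y ∈ closedBall 0 R,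
      ∀ b ∈ closedBall 0 1, |l₂ t x b - l₂ t y b| ≤ K * ‖x - y‖) (hε0 : 0 ≤ ε)
    (hε : ∀ t ∈ Icc 0 T, ∀ x ∈ closedBall 0 R, ∀ b ∈ closedBall 0 1,
      |l₁ t x b - l₂ t x b| ≤ ε) {D : ℝ} (hD0 : 0 ≤ D)
    (hD : ∀ t ∈ Icc t₀ T, ‖x₁ t - x₂ t‖ ≤ D) :
    |(∫ t in t₀..T, l₁ t (x₁ t) (a t)) - ∫ t in t₀..T, l₂ t (x₂ t) (a t)| ≤ (ε + K * D) * T := by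
  rw [← intervalIntegral.integral_sub (hS₁.intervalIntegrable_cost ht₀ hp₁).1
    (hS₂.intervalIntegrable_cost ht₀ hp₂).1]
  have h1 := intervalIntegral.norm_integral_le_of_norm_le_const_ae (C := ε + K * D)
    (a := t₀) (b := T) (f := fun t => l₁ t (x₁ t) (a t) - l₂ t (x₂ t) (a t)) (by
      filter_upwards [(ae_restrict_iff' measurableSet_Icc).1 hp₁.control_mem] with s hs hsm
      rw [uIoc_of_le ht₀.2] at hsm
      have hs' := Ioc_subset_Icc_self hsm
      have hs0 : s ∈ Icc 0 T := ⟨ht₀.1.trans hs'.1, hs'.2⟩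
      have e1 := hε s hs0 _ (hx₁ s hs') _ (hs hs')
      have e2 := hlip s hs0 _ (hx₁ s hs') _ (hx₂ s hs') _ (hs hs')
      have e3 := abs_sub_le (l₁ s (x₁ s) (a s)) (l₂ s (x₁ s) (a s)) (l₂ s (x₂ s) (a s))
      have e4 := mul_le_mul_of_nonneg_left (hD s hs') hK.le
      rw [Real.norm_eq_abs]
      linarith)
  rw [abs_of_nonneg (by linarith [ht₀.2])] at h1
  exact h1.trans (mul_le_mul_of_nonneg_left (by linarith [ht₀.1]) (by positivity))

/-- Stability of the value functions of regular control systems. -/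
theorem tendsto_valueFunction {fs : ℕ → ℝ → EuclideanSpace ℝ (Fin n) → EuclideanSpace ℝ (Fin m) →
      EuclideanSpace ℝ (Fin n)}
    {ls : ℕ → ℝ → EuclideanSpace ℝ (Fin n) → EuclideanSpace ℝ (Fin m) → ℝ}
    {gs : ℕ → EuclideanSpace ℝ (Fin n) → ℝ} {g : EuclideanSpace ℝ (Fin n) → ℝ}
    (hT : 0 ≤ T) (hSs : ∀ᶠ i in atTop, IsRegularSystem T C (fs i) (ls i))
    (hS : IsRegularSystem T C f l)
    (hgs : ∀ i, Continuous (gs i)) (hg : Continuous g)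
    (hlim : ∀ R > 0, ∀ ε > 0, ∀ᶠ i in atTop, ∀ t ∈ Icc 0 T, ∀ x ∈ closedBall 0 R,
      ∀ a ∈ closedBall 0 1, ‖fs i t x a - f t x a‖ ≤ ε ∧ |ls i t x a - l t x a| ≤ ε)
    (hg_lim : TendstoUniformlyOnCompactsIn gs g univ) :
    TendstoUniformlyOnCompactsIn
      (fun i (z : ℝ × EuclideanSpace ℝ (Fin n)) =>
        valueFunction (closedBall 0 1) (fs i) (ls i) (gs i) T z.1 z.2)
      (fun z => valueFunction (closedBall 0 1) f l g T z.1 z.2) (Icc 0 T ×ˢ univ) := by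
  intro S hSsub hScomp
  obtain ⟨r, hr0, hr⟩ : ∃ r : ℝ, 0 ≤ r ∧ ∀ z ∈ S, ‖z.2‖ ≤ r := by
    obtain ⟨r, hr⟩ := hScomp.bddAbove_image (f := fun z => ‖z.2‖) (by fun_prop)
    exact ⟨max r 0, le_max_right _ _, fun z hz =>
      (hr (mem_image_of_mem _ hz)).trans (le_max_left _ _)⟩
  set R := (1 + r) * Real.exp (C * T) with hR
  have hR0 : 0 < R := by positivity
  obtain ⟨K, hK, hlip⟩ := hS.lipschitz R hR0
  rw [Metric.tendstoUniformlyOn_iff]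
  intro η hη
  obtain ⟨δ, hδ, huc⟩ := Metric.uniformContinuousOn_iff.1
    ((isCompact_closedBall (0 : EuclideanSpace ℝ (Fin n)) R).uniformContinuousOn_of_continuous
      hg.continuousOn) (η / 4) (by positivity)
  set A := Real.exp (K * T) / K with hA
  have hA0 : 0 < A := by positivity
  -- The first entry keeps endpoints within δ, so g changes by less than η/4; the second keeps the
  -- running costs within η/4. The summand 1 keeps the denominator positive when T = 0.
  set ε := min (δ / (2 * A)) (η / (4 * (1 + (1 + K * A) * T))) with hε
  have hε0 : 0 < ε := by positivity
  have hεδ : ε * A < δ := by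
    have h1 : ε * (2 * A) ≤ δ := (le_div_iff₀ (by positivity)).1 (min_le_left _ _)
    nlinarith
  have hεη : (ε + K * (ε * A)) * T ≤ η / 4 := by
    have h1 : ε * (4 * (1 + (1 + K * A) * T)) ≤ η :=
      (le_div_iff₀ (by positivity)).1 (min_le_right _ _)
    linarith
  have hgl := Metric.tendstoUniformlyOn_iff.1 (hg_lim (closedBall 0 R) (subset_univ _)
    (isCompact_closedBall _ _)) (η / 4) (by positivity)
  filter_upwards [hSs, hlim R hR0 ε hε0, hgl] with i hSi hi hgi z hz
  obtain ⟨ht₀, -⟩ := hSsub hz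
  -- Both systems are driven by the same control. The three errors of size η/4 are the change of
  -- terminal cost function, the change of endpoint, and the running cost.
  have hpair : ∀ {x₁ x₂ : ℝ → EuclideanSpace ℝ (Fin n)} {a : ℝ → EuclideanSpace ℝ (Fin m)},
      IsTrajectoryControlPair (fs i) (closedBall 0 1) T z.1 z.2 x₁ a →
      IsTrajectoryControlPair f (closedBall 0 1) T z.1 z.2 x₂ a →
      |(gs i (x₁ T) + ∫ t in z.1..T, ls i t (x₁ t) (a t)) -
        (g (x₂ T) + ∫ t in z.1..T, l t (x₂ t) (a t))| ≤ 3 * η / 4 := by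
    intro x₁ x₂ a hp₁ hp₂
    have hx₁ := hSi.trajectory_mem_closedBall ht₀ hp₁ (hr z hz)
    have hx₂ := hS.trajectory_mem_closedBall ht₀ hp₂ (hr z hz)
    have hD := norm_trajectory_sub_le hSi hS ht₀ hp₁ hp₂ hx₁ hx₂ hK
      (fun t ht x hx y hy b hb => (hlip t ht x hx y hy b hb).1) hε0.le
      (fun t ht x hx b hb => (hi t ht x hx b hb).1)
    have hI := abs_integral_cost_sub_le hSi hS ht₀ hp₁ hp₂ hx₁ hx₂ hK
      (fun t ht x hx y hy b hb => (hlip t ht x hx y hy b hb).2) hε0.le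
      (fun t ht x hx b hb => (hi t ht x hx b hb).2) (by positivity) hD
    have hTm : T ∈ Icc z.1 T := right_mem_Icc.2 ht₀.2
    have h1 := hgi (x₁ T) (hx₁ T hTm)
    have h2 := huc (x₁ T) (hx₁ T hTm) (x₂ T) (hx₂ T hTm) (by
      rw [dist_eq_norm]; exact (hD T hTm).trans_lt hεδ)
    rw [dist_comm, Real.dist_eq] at h1
    rw [Real.dist_eq] at h2
    have e1 := abs_lt.1 h1
    have e2 := abs_lt.1 h2
    have e3 := abs_le.1 (hI.trans hεη)
    rw [abs_le]
    constructor <;> linarith [e1.1, e1.2, e2.1, e2.2, e3.1, e3.2]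
  obtain ⟨-, hne₁, hb₁⟩ := hSi.valueWellDefined (hgs i) z.1 ht₀ z.2
  obtain ⟨-, hne₂, hb₂⟩ := hS.valueWellDefined hg z.1 ht₀ z.2
  rw [dist_comm, Real.dist_eq]
  refine (abs_csInf_sub_csInf_le hne₁ hne₂ hb₁ hb₂ ?_ ?_).trans_lt
    (show 3 * η / 4 < η by linarith)
  · rintro _ ⟨x₁, a, hp₁, rfl⟩
    obtain ⟨x₂, hp₂⟩ := hS.exists_trajectory ht₀ z.2 hp₁.control_measurable hp₁.control_mem
    exact ⟨_, ⟨x₂, a, hp₂, rfl⟩, hpair hp₁ hp₂⟩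
  · rintro _ ⟨x₂, a, hp₂, rfl⟩
    obtain ⟨x₁, hp₁⟩ := hSi.exists_trajectory ht₀ z.2 hp₂.control_measurable hp₂.control_mem
    refine ⟨_, ⟨x₁, a, hp₁, rfl⟩, ?_⟩
    rw [abs_sub_comm]
    exact hpair hp₁ hp₂

end IsRegularSystem

/-- The constructed representation of a continuous Hamiltonian is a regular control system. -/
theorem isRegularSystem_representation
    {H : ℝ → EuclideanSpace ℝ (Fin n) → EuclideanSpace ℝ (Fin n) → ℝ}
    {lam : ℝ → EuclideanSpace ℝ (Fin n) → ℝ} {c : ℝ → ℝ} {k : ℝ → ℝ → ℝ}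
    (hH : HamiltonianConditions T H c k) (hL : BoundedLagrangian T H lam k)
    (hJ : JointlyContinuous T H lam c) (hk : ∀ R > 0, ContinuousOn (k R) (Icc 0 T))
    (hC : 0 ≤ C) (hcC : ∀ t ∈ Icc 0 T, c t ≤ C) :
    IsRegularSystem T C (repDynamics H lam c) (repCost H lam c) where
  growth_nonneg := hC
  growth t ht x a := (hH.norm_repDynamics_le ht x a).trans
    (mul_le_mul_of_nonneg_right (hcC t ht) (by positivity))
  continuous_dynamics := (continuous_proj₁.comp_continuousOn
    (hJ.continuousOn_epiParam hH hL)).mono (prod_mono_right (subset_univ _))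
  continuous_cost := (continuous_proj₂.comp_continuousOn
    (hJ.continuousOn_epiParam hH hL)).mono (prod_mono_right (subset_univ _))
  lipschitz R hR := by
    obtain ⟨M, hM⟩ := isCompact_Icc.bddAbove_image (hk R hR)
    -- The summand 1 only makes the constant strictly positive, as the division by K in the Grönwall
    -- bound requires.
    refine ⟨(n + 1) * (10 * (4 * |M| + C)) + 1, by positivity, fun t ht x hx y hy a ha => ?_⟩
    have h1 := hH.dist_epiParam_le hL hR ht hx hy ha
    have h2 : k R t ≤ |M| := (hM (mem_image_of_mem _ ht)).trans (le_abs_self M)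
    have h3 : dist (epiParam H lam c t x a) (epiParam H lam c t y a) ≤
        ((n + 1) * (10 * (4 * |M| + C)) + 1) * ‖x - y‖ := by
      refine h1.trans (mul_le_mul_of_nonneg_right ?_ (norm_nonneg _))
      have := mul_le_mul_of_nonneg_left (show 10 * (4 * k R t + c t) ≤ 10 * (4 * |M| + C) by
        linarith [hcC t ht]) (show (0 : ℝ) ≤ n + 1 by positivity)
      linarith
    rw [dist_eq_norm] at h3
    constructor
    · rw [repDynamics, repDynamics, ← proj₁_sub]
      exact (norm_proj₁_le _).trans h3
    · rw [repCost, repCost, ← proj₂_sub]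
      exact (abs_proj₂_le _).trans h3

end Stability

/-! ### The stability corollary -/

theorem corollary3p3 (n : ℕ) (hn : 1 ≤ n) (T : ℝ) (hT : 0 < T)
    (Hs : ℕ → ℝ → EuclideanSpace ℝ (Fin n) → EuclideanSpace ℝ (Fin n) → ℝ)
    (H : ℝ → EuclideanSpace ℝ (Fin n) → EuclideanSpace ℝ (Fin n) → ℝ)
    (lams : ℕ → ℝ → EuclideanSpace ℝ (Fin n) → ℝ) (lam : ℝ → EuclideanSpace ℝ (Fin n) → ℝ)
    (ks : ℕ → ℝ → ℝ → ℝ) (k : ℝ → ℝ → ℝ)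
    (cs : ℕ → ℝ → ℝ) (c : ℝ → ℝ)
    (gs : ℕ → EuclideanSpace ℝ (Fin n) → ℝ) (g : EuclideanSpace ℝ (Fin n) → ℝ)
    -- standing hypotheses for every index and for the limit
    (hHs : ∀ i, HamiltonianConditions T (Hs i) (cs i) (ks i))
    (hH : HamiltonianConditions T H c k)
    (hLs : ∀ i, BoundedLagrangian T (Hs i) (lams i) (ks i))
    (hL : BoundedLagrangian T H lam k)
    -- continuity
    (hHs_cont : ∀ i, ContinuousOn
      (fun z : ℝ × EuclideanSpace ℝ (Fin n) × EuclideanSpace ℝ (Fin n) => Hs i z.1 z.2.1 z.2.2)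
      (Icc 0 T ×ˢ univ))
    (hlams_cont : ∀ i, ContinuousOn
      (fun z : ℝ × EuclideanSpace ℝ (Fin n) => lams i z.1 z.2) (Icc 0 T ×ˢ univ))
    (hks_cont : ∀ i, ∀ R > 0, ContinuousOn (ks i R) (Icc 0 T))
    (hcs_cont : ∀ i, ContinuousOn (cs i) (Icc 0 T))
    (hgs_cont : ∀ i, Continuous (gs i))
    -- uniform convergence on compacts
    (hH_lim : TendstoUniformlyOnCompactsIn
      (fun i (z : ℝ × EuclideanSpace ℝ (Fin n) × EuclideanSpace ℝ (Fin n)) =>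
        Hs i z.1 z.2.1 z.2.2)
      (fun z => H z.1 z.2.1 z.2.2) (Icc 0 T ×ˢ univ))
    (hlam_lim : TendstoUniformlyOnCompactsIn
      (fun i (z : ℝ × EuclideanSpace ℝ (Fin n)) => lams i z.1 z.2)
      (fun z => lam z.1 z.2) (Icc 0 T ×ˢ univ))
    (hk_lim : ∀ R > 0, TendstoUniformlyOnCompactsIn (fun i => ks i R) (k R) (Icc 0 T))
    (hc_lim : TendstoUniformlyOnCompactsIn cs c (Icc 0 T))
    (hg_lim : TendstoUniformlyOnCompactsIn gs g univ) :
    (∀ i, ValueWellDefined (closedBall 0 1) (repDynamics (Hs i) (lams i) (cs i))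
      (repCost (Hs i) (lams i) (cs i)) (gs i) T) ∧
    ValueWellDefined (closedBall 0 1) (repDynamics H lam c) (repCost H lam c) g T ∧
    TendstoUniformlyOnCompactsIn
      (fun i (z : ℝ × EuclideanSpace ℝ (Fin n)) =>
        valueFunction (closedBall 0 1) (repDynamics (Hs i) (lams i) (cs i))
          (repCost (Hs i) (lams i) (cs i)) (gs i) T z.1 z.2)
      (fun z => valueFunction (closedBall 0 1) (repDynamics H lam c) (repCost H lam c) g T
        z.1 z.2)
      (Icc 0 T ×ˢ univ) := by
  have hSclosed : IsClosed (Icc (0 : ℝ) T) := isClosed_Icc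
  have hJs : ∀ i, JointlyContinuous T (Hs i) (lams i) (cs i) := fun i =>
    ⟨hHs_cont i, hlams_cont i, hcs_cont i⟩
  -- The limit data inherit continuity from locally uniform convergence.
  have hJ : JointlyContinuous T H lam c :=
    ⟨hH_lim.continuousOn (hSclosed.prod isClosed_univ) hHs_cont,
      hlam_lim.continuousOn (hSclosed.prod isClosed_univ) hlams_cont,
      hc_lim.continuousOn hSclosed hcs_cont⟩
  have hk_cont : ∀ R > 0, ContinuousOn (k R) (Icc 0 T) := fun R hR =>
    (hk_lim R hR).continuousOn hSclosed fun i => hks_cont i R hR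
  have hg_cont : Continuous g := continuousOn_univ.1
    (hg_lim.continuousOn isClosed_univ fun i => (hgs_cont i).continuousOn)
  have hbound : ∀ {c : ℝ → ℝ}, ContinuousOn c (Icc 0 T) → ∃ C, 0 ≤ C ∧ ∀ t ∈ Icc 0 T, c t ≤ C := by
    intro c hc
    obtain ⟨C, hC⟩ := isCompact_Icc.bddAbove_image hc
    exact ⟨max C 0, le_max_right _ _, fun t ht =>
      (hC (mem_image_of_mem _ ht)).trans (le_max_left _ _)⟩
  obtain ⟨C, hC0, hC⟩ := hbound hJ.growth
  -- Since c_i ≤ c + 1 for large i, the constant C + 1 serves the limit and all late systems at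
  -- once. Well-posedness for an arbitrary index uses its own bound instead.
  have hS : IsRegularSystem T (C + 1) (repDynamics H lam c) (repCost H lam c) :=
    isRegularSystem_representation hH hL hJ hk_cont (by positivity)
      fun t ht => (hC t ht).trans (by linarith)
  refine ⟨fun i => ?_, hS.valueWellDefined hg_cont, ?_⟩
  · obtain ⟨Ci, hCi0, hCi⟩ := hbound (hcs_cont i)
    exact (isRegularSystem_representation (hHs i) (hLs i) (hJs i) (hks_cont i) hCi0
      hCi).valueWellDefined (hgs_cont i)
  · refine IsRegularSystem.tendsto_valueFunction hT.le ?_ hS hgs_cont hg_cont ?_ hg_lim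
    · filter_upwards [Metric.tendstoUniformlyOn_iff.1 (hc_lim _ subset_rfl isCompact_Icc) 1
        one_pos] with i hi
      refine isRegularSystem_representation (hHs i) (hLs i) (hJs i) (hks_cont i) (by positivity)
        fun t ht => ?_
      have h1 := hi t ht
      rw [dist_comm, Real.dist_eq] at h1
      linarith [(abs_lt.1 h1).2, hC t ht]
    · intro R hR ε hε
      filter_upwards [eventually_dist_epiParam_le hHs hH hLs hL hJ hH_lim hlam_lim hc_lim R hR.le
        hε] with i hi t ht x hx a ha
      have h1 := hi t ht x hx a ha
      rw [dist_eq_norm] at h1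
      constructor
      · rw [repDynamics, repDynamics, ← proj₁_sub]
        exact (norm_proj₁_le _).trans h1
      · rw [repCost, repCost, ← proj₂_sub]
        exact (abs_proj₂_le _).trans h1
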